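/- Let $1<p<\infty$, let $\mathbb T$ be the unit circle and $\mathbb D$ the open unit disc in $\mathbb C$, let $H^p\subset L^p=L^p(\mathbb T)$ be the Hardy space (the functions in $L^p$ whose Fourier coefficients with negative index vanish), and let $\mathbb P$ be the Riesz projection of $L^p$ onto $H^p$. Let $\mathcal P=\mathbb C[z]$ and let $\mathcal P_n\subset\mathcal P$ be the subspace of polynomials of degree at most $n$, with $\mathcal P_n=\{0\}$ for $n<0$ and $\deg 0=-\infty$; polynomials are also viewed as elements of $H^p$. Poles and zeroes of rational functions are taken in $\mathbb C$ (not at infinity). For a rational function $\omega$, let $T_\omega$ be the (possibly unbounded) operator on $H^p$ given by $$\mathrm{Dom}(T_\omega)=\{g\in H^p \mid \omega g=f+\rho \text{ with } f\in L^p,\ \rho \text{ a strictly proper rational function with all its poles on } \mathbb T\},\qquad T_\omega g=\mathbb P f .$$ A closed linear operator is called Fredholm if its kernel is finite dimensional and its range has a finite dimensional complement; its index is the dimension of the kernel minus the dimension of a complement of the range. **Theorem 1.2.** Let $\omega$ be a rational function all of whose poles lie on $\mathbb T$, say $\omega=s/q$ with $s,q\in\mathcal P$ coprime, $q\neq0$.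 Then $T_\omega$ is Fredholm if and only if $\omega$ has no zeroes on $\mathbb T$ (the function $\omega=0$ being regarded as having zeroes on $\mathbb T$). Assume that $s$ has no roots on $\mathbb T$, and factor $s=s_-s_+$ with polynomials $s_-$ and $s_+$ having roots only inside and only outside $\mathbb T$, respectively. Then $$\mathrm{Dom}(T_\omega)=qH^p+\mathcal P_{\deg(q)-1},\qquad \mathrm{Ran}(T_\omega)=sH^p+\widetilde{\mathcal P},\qquad \ker(T_\omega)=\Big\{\frac{r_0}{s_+}\ \Big|\ r_0\in\mathcal P,\ \deg(r_0)<\deg(q)-\deg(s_-)\Big\},$$ where $\widetilde{\mathcal P}$ is the subspace of $\mathcal P_{\deg(s)-1}$ given by $$\widetilde{\mathcal P}=\{r\in\mathcal P\mid rq=r_1s+r_2 \text{ for some } r_1,r_2\in\mathcal P_{\deg(q)-1}\}.$$ Moreover, $\mathcal P_{\deg(s_-)-\deg(q)-1}$ is a complement of $\mathrm{Ran}(T_\omega)$ in $H^p$. In particular, $T_\omega$ is injective or surjective, and it is both injective and surjective if and only if $\deg(s_-)=\deg(q)$. The Fredholm index of $T_\omega$ is the number of poles of $\omega$ minus the number of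 zeroes of $\omega$ in $\mathbb D$, in both cases counted with multiplicity. -/

import Mathlib

open MeasureTheory Polynomial Filter Topology
open scoped ENNReal

noncomputable section

namespace RationalToeplitz

/-! ### The circle and its function spaces

The circle is parametrised by `t ∈ ℝ/ℤ`, the corresponding point being `z = e^{2πit}`. -/

/-- Normalised arc length on the unit circle. -/
abbrev haarT : Measure UnitAddCircle := AddCircle.haarAddCircle

/-- `L^p` of the unit circle. -/
abbrev LpT (p : ℝ≥0∞) : Type := Lp ℂ p haarT

/-- Measurable functions on the unit circle modulo equality almost everywhere. -/
abbrev L0T : Type := UnitAddCircle →ₘ[haarT] ℂ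

theorem continuous_eval_circle (r : ℂ[X]) :
    Continuous fun t : UnitAddCircle => r.eval (t.toCircle : ℂ) :=
  r.continuous.comp (continuous_subtype_val.comp AddCircle.continuous_toCircle)

theorem aestronglyMeasurable_eval (R : RatFunc ℂ) :
    AEStronglyMeasurable
      (fun t : UnitAddCircle => R.eval (RingHom.id ℂ) (t.toCircle : ℂ)) haarT := by
  refine Measurable.aestronglyMeasurable ?_
  exact (continuous_eval_circle R.num).measurable.div (continuous_eval_circle R.denom).measurable

/-- The restriction of a rational function to the unit circle, as a class of measurable functions
modulo equality a.e.; the finitely many poles on the circle form a null set. -/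
def bd (R : RatFunc ℂ) : L0T :=
  AEEqFun.mk (fun t : UnitAddCircle => R.eval (RingHom.id ℂ) (t.toCircle : ℂ))
    (aestronglyMeasurable_eval R)

/-- The restriction of a polynomial to the unit circle. -/
abbrev bdPoly (r : ℂ[X]) : L0T := bd (algebraMap ℂ[X] (RatFunc ℂ) r)

theorem ae_eval_ne_zero {r : ℂ[X]} (hr : r ≠ 0) :
    ∀ᵐ t : UnitAddCircle ∂haarT, r.eval (t.toCircle : ℂ) ≠ 0 := by
  have : {t : UnitAddCircle | ¬ r.eval (t.toCircle : ℂ) ≠ 0}.Finite := by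
    have h1 : {z : ℂ | r.eval z = 0}.Finite := by
      simpa [IsRoot] using Polynomial.finite_setOfPred_isRoot hr
    have := h1.preimage (f := fun t : UnitAddCircle => (t.toCircle : ℂ))
      (Set.injOn_of_injective (Circle.coe_injective.comp (AddCircle.injective_toCircle one_ne_zero)))
    simpa using this
  have : NullSingletonClass (haarT) := ⟨fun x => by
    have h := AddCircle.volume_closedBall 1 (x := x) 0
    simpa [AddCircle.volume_eq_smul_haarAddCircle] using h⟩
  exact Set.Finite.measure_zero (by assumption) _



theorem coeFn_bd_div (a b : ℂ[X]) :
    (bd (algebraMap ℂ[X] (RatFunc ℂ) a / algebraMap ℂ[X] (RatFunc ℂ) b) : UnitAddCircle → ℂ)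
      =ᵐ[haarT] fun t => a.eval (t.toCircle : ℂ) / b.eval (t.toCircle : ℂ) := by
  rcases eq_or_ne b 0 with rfl | hb
  · have h := AEEqFun.coeFn_mk _ (aestronglyMeasurable_eval
      (algebraMap ℂ[X] (RatFunc ℂ) a / algebraMap ℂ[X] (RatFunc ℂ) 0))
    simpa [bd] using h
  set R := algebraMap ℂ[X] (RatFunc ℂ) a / algebraMap ℂ[X] (RatFunc ℂ) b with hR
  filter_upwards [AEEqFun.coeFn_mk _ (aestronglyMeasurable_eval R),
    ae_eval_ne_zero (RatFunc.denom_ne_zero R), ae_eval_ne_zero hb] with t h1 h2 h3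
  have h4 : R.num * b = a * R.denom := (RatFunc.num_mul_eq_mul_denom_iff hb).2 hR
  have h5 := congrArg (Polynomial.eval (t.toCircle : ℂ)) h4
  simp only [Polynomial.eval_mul] at h5
  rw [bd, h1, RatFunc.eval, ← Polynomial.eval, ← Polynomial.eval, div_eq_div_iff h2 h3, h5]

theorem coeFn_bdPoly (r : ℂ[X]) :
    (bdPoly r : UnitAddCircle → ℂ) =ᵐ[haarT] fun t => r.eval (t.toCircle : ℂ) := by
  have h := coeFn_bd_div r 1
  simpa using h

theorem integrable_LpT {p : ℝ≥0∞} [hp : Fact (1 ≤ p)] (f : LpT p) : Integrable f haarT :=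
  (Lp.memLp f).integrable hp.out

theorem fourierCoeff_Lp_add {p : ℝ≥0∞} [Fact (1 ≤ p)] (f g : LpT p) (n : ℤ) :
    fourierCoeff (f + g : LpT p) n = fourierCoeff f n + fourierCoeff g n := by
  rw [fourierCoeff_congr_ae (Lp.coeFn_add f g),
    fourierCoeff.add (integrable_LpT f) (integrable_LpT g)]
  rfl

theorem fourierCoeff_Lp_smul {p : ℝ≥0∞} [Fact (1 ≤ p)] (c : ℂ) (f : LpT p) (n : ℤ) :
    fourierCoeff (c • f : LpT p) n = c * fourierCoeff f n := by
  rw [fourierCoeff_congr_ae (Lp.coeFn_smul c f)]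
  exact fourierCoeff.const_smul _ _ _

/-- The functions in `L^p` whose Fourier coefficients vanish at all indices outside `A`. -/
def spectralSubspace (p : ℝ≥0∞) [Fact (1 ≤ p)] (A : Set ℤ) : Submodule ℂ (LpT p) where
  carrier := {f | ∀ n ∉ A, fourierCoeff f n = 0}
  add_mem' := by
    intro f g hf hg n hn
    rw [fourierCoeff_Lp_add, hf n hn, hg n hn, add_zero]
  zero_mem' := by
    intro n hn
    rw [fourierCoeff_congr_ae (Lp.coeFn_zero _ _ _)]
    simp [fourierCoeff]
  smul_mem' := by
    intro c f hf n hn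
    rw [fourierCoeff_Lp_smul, hf n hn, mul_zero]

/-- The Hardy space `H^p`, as a subspace of `L^p` of the circle. -/
abbrev Hp (p : ℝ≥0∞) [Fact (1 ≤ p)] : Submodule ℂ (LpT p) := spectralSubspace p {n | 0 ≤ n}

/-- The standard complement `K^p` of `H^p` in `L^p`. -/
abbrev Kp (p : ℝ≥0∞) [Fact (1 ≤ p)] : Submodule ℂ (LpT p) := spectralSubspace p {n | n < 0}

/-- `h = ℙ f`, where `ℙ` is the Riesz projection of `L^p` onto `H^p` along `K^p`. -/
def IsRieszProjection {p : ℝ≥0∞} [Fact (1 ≤ p)] (f : LpT p) (h : Hp p) : Prop :=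
  f - (h : LpT p) ∈ Kp p

/-- An element of `H^p` as a class of measurable functions on the circle. -/
abbrev toL0 {p : ℝ≥0∞} [Fact (1 ≤ p)] (h : Hp p) : L0T := ((h : LpT p) : L0T)

theorem bd_add (x y : RatFunc ℂ) : bd (x + y) = bd x + bd y := by
  refine AEEqFun.ext ?_
  filter_upwards [AEEqFun.coeFn_mk _ (aestronglyMeasurable_eval (x + y)),
    AEEqFun.coeFn_add (bd x) (bd y), AEEqFun.coeFn_mk _ (aestronglyMeasurable_eval x),
    AEEqFun.coeFn_mk _ (aestronglyMeasurable_eval y),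
    ae_eval_ne_zero (RatFunc.denom_ne_zero x), ae_eval_ne_zero (RatFunc.denom_ne_zero y)]
    with t h1 h2 h3 h4 h5 h6
  rw [h2, Pi.add_apply]
  simp only [bd]
  rw [h1, h3, h4, RatFunc.eval_add]
  · exact h5
  · exact h6

theorem bd_zero : bd 0 = 0 := by
  refine AEEqFun.ext ?_
  filter_upwards [AEEqFun.coeFn_mk _ (aestronglyMeasurable_eval 0),
    AEEqFun.coeFn_zero (μ := haarT) (β := ℂ)] with t h1 h2
  rw [bd, h1, h2, RatFunc.eval_zero, Pi.zero_apply]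

theorem bd_smul (c : ℂ) (x : RatFunc ℂ) : bd (c • x) = c • bd x := by
  refine AEEqFun.ext ?_
  filter_upwards [AEEqFun.coeFn_mk _ (aestronglyMeasurable_eval (c • x)),
    AEEqFun.coeFn_smul c (bd x), AEEqFun.coeFn_mk _ (aestronglyMeasurable_eval x),
    ae_eval_ne_zero (RatFunc.denom_ne_zero x)] with t h1 h2 h3 h4
  rw [h2, Pi.smul_apply]
  simp only [bd]
  rw [h1, h3, RatFunc.smul_eq_C_mul, RatFunc.eval_mul, RatFunc.eval_C]
  · rfl
  · simp
  · exact h4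

theorem L0_mul_add (u v w : L0T) : u * (v + w) = u * v + u * w := by
  refine AEEqFun.ext ?_
  filter_upwards [AEEqFun.coeFn_mul u (v + w), AEEqFun.coeFn_add v w,
    AEEqFun.coeFn_add (u * v) (u * w), AEEqFun.coeFn_mul u v, AEEqFun.coeFn_mul u w]
    with t h1 h2 h3 h4 h5
  simp only [h1, h2, h3, h4, h5, Pi.mul_apply, Pi.add_apply, mul_add]

theorem L0_mul_smul (c : ℂ) (u v : L0T) : u * (c • v) = c • (u * v) := by
  refine AEEqFun.ext ?_
  filter_upwards [AEEqFun.coeFn_mul u (c • v), AEEqFun.coeFn_smul c v,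
    AEEqFun.coeFn_smul c (u * v), AEEqFun.coeFn_mul u v] with t h1 h2 h3 h4
  simp only [h1, h2, h3, h4, Pi.mul_apply, Pi.smul_apply, smul_eq_mul]
  ring

theorem L0_mul_zero (u : L0T) : u * 0 = 0 := by
  refine AEEqFun.ext ?_
  filter_upwards [AEEqFun.coeFn_mul u 0, AEEqFun.coeFn_zero (μ := haarT) (β := ℂ)] with t h1 h2
  rw [h1, Pi.mul_apply, h2, Pi.zero_apply, mul_zero]

/-! ### Fourier coefficients -/

theorem tendsto_fourierCoeff {f : UnitAddCircle → ℂ} :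
    Tendsto (fun n : ℤ => fourierCoeff f n) cofinite (𝓝 0) := by
  have h := Real.tendsto_integral_exp_smul_cocompact
    ((Set.Ioc (0:ℝ) 1).indicator fun x : ℝ => f (x : UnitAddCircle))
  have h2 := h.comp Int.tendsto_coe_cofinite
  refine h2.congr fun n => ?_
  rw [fourierCoeff_eq_intervalIntegral f n 0]
  simp only [Function.comp]
  rw [intervalIntegral.integral_of_le (by norm_num), ← integral_indicator measurableSet_Ioc]
  simp only [zero_add, div_one, one_smul]
  congr 1
  ext x
  by_cases hx : x ∈ Set.Ioc (0:ℝ) 1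
  · simp only [Set.indicator_of_mem hx]
    rw [fourier_coe_apply, Circle.smul_def, Real.fourierChar_apply]
    congr 2
    push_cast; ring_nf
  · simp [Set.indicator_of_notMem hx]

theorem ae_zero_of_fourierCoeff {f : UnitAddCircle → ℂ} (hf : Integrable f haarT)
    (h : ∀ n, fourierCoeff f n = 0) : f =ᵐ[haarT] 0 := by
  have hc : ∀ φ : C(UnitAddCircle, ℂ), ∫ t, φ t * f t ∂haarT = 0 := by
    have hi : ∀ φ : C(UnitAddCircle, ℂ), Integrable (fun t => φ t * f t) haarT := fun φ =>
      hf.bdd_mul (c := ‖φ‖) φ.continuous.aestronglyMeasurable (ae_of_all _ fun t => φ.norm_coe_le_norm t)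
    let L : C(UnitAddCircle, ℂ) →ₗ[ℂ] ℂ :=
      { toFun := fun φ => ∫ t, φ t * f t ∂haarT
        map_add' := fun φ ψ => by
          rw [← integral_add (hi φ) (hi ψ)]; simp [add_mul]
        map_smul' := fun c φ => by
          simp [mul_assoc, integral_const_mul] }
    let L' : C(UnitAddCircle, ℂ) →L[ℂ] ℂ := L.mkContinuous (∫ t, ‖f t‖ ∂haarT) (by
      intro φ
      refine (norm_integral_le_integral_norm _).trans ?_
      rw [← integral_mul_const]
      refine integral_mono (hi φ).norm (hf.norm.mul_const _) fun t => ?_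
      simp only [norm_mul]
      rw [mul_comm]
      gcongr
      exact φ.norm_coe_le_norm t)
    have hk : (Submodule.span ℂ (Set.range (@fourier 1))).topologicalClosure ≤ L'.ker := by
      refine Submodule.topologicalClosure_minimal _ ?_ L'.isClosed_ker
      rw [Submodule.span_le]
      rintro _ ⟨n, rfl⟩
      have := h (-n)
      simp only [fourierCoeff, neg_neg, smul_eq_mul] at this
      simpa [L', L] using this
    rw [span_fourier_closure_eq_top] at hk
    exact fun φ => hk (Submodule.mem_top (x := φ))
  refine ae_eq_zero_of_forall_setIntegral_isClosed_eq_zero hf fun s hs => ?_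
  let δ : ℕ → ℝ := fun n => 1 / ((n:ℝ) + 1)
  have δpos : ∀ n, 0 < δ n := fun n => by positivity
  let φ : ℕ → C(UnitAddCircle, ℂ) := fun n =>
    ⟨fun t => ((thickenedIndicator (δpos n) s t : NNReal) : ℂ), by fun_prop⟩
  have hlim : Tendsto (fun n => ∫ t, φ n t * f t ∂haarT) atTop
      (𝓝 (∫ t, s.indicator f t ∂haarT)) := by
    refine tendsto_integral_of_dominated_convergence (fun t => ‖f t‖) (fun n => ?_) hf.norm ?_ ?_
    · exact (φ n).continuous.aestronglyMeasurable.mul hf.aestronglyMeasurable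
    · intro n
      refine ae_of_all _ fun t => ?_
      rw [norm_mul]
      refine mul_le_of_le_one_left (norm_nonneg _) ?_
      have := thickenedIndicator_le_one (δpos n) s t
      simpa [φ] using this
    · refine ae_of_all _ fun t => ?_
      have h1 := thickenedIndicator_tendsto_indicator_closure δpos
        (tendsto_one_div_add_atTop_nhds_zero_nat) s
      have h2 := (tendsto_pi_nhds.1 h1) t
      rw [hs.closure_eq] at h2
      have h3 : Tendsto (fun n => φ n t) atTop (𝓝 (((s.indicator (fun _ => (1:NNReal)) t : NNReal) : ℂ))) := by
        have hcont : Continuous fun x : NNReal => ((x : ℝ) : ℂ) := by fun_prop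
        exact (hcont.tendsto _).comp h2
      have h4 := h3.mul_const (f t)
      convert h4 using 2
      by_cases ht : t ∈ s <;> simp [ht]
  rw [integral_indicator hs.measurableSet] at hlim
  simp only [hc] at hlim
  exact tendsto_nhds_unique hlim tendsto_const_nhds

theorem fourierCoeff_sub_root {f : UnitAddCircle → ℂ} (hf : Integrable f haarT) (α : ℂ) (n : ℤ) :
    fourierCoeff (fun t => ((t.toCircle : ℂ) - α) * f t) n
      = fourierCoeff f (n - 1) - α * fourierCoeff f n := by
  simp only [fourierCoeff, smul_eq_mul]
  have hi : ∀ k : ℤ, Integrable (fun t => fourier k t * f t) haarT := fun k =>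
    hf.bdd_mul (c := ‖fourier (T := 1) k‖) (fourier k).continuous.aestronglyMeasurable
      (ae_of_all _ fun t => (fourier k).norm_coe_le_norm t)
  rw [← integral_const_mul, ← integral_sub (hi _) ((hi _).const_mul _)]
  congr 1
  ext t
  have : fourier (-(n-1)) t = fourier (-n) t * (t.toCircle : ℂ) := by
    rw [← fourier_one, ← fourier_add, show -(n - 1) = -n + 1 by ring]
  rw [this]; ring_nf

theorem fourierCoeff_eval_mul (r : ℂ[X]) {f : UnitAddCircle → ℂ} (hf : Integrable f haarT)
    (n : ℤ) : fourierCoeff (fun t => r.eval (t.toCircle : ℂ) * f t) n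
      = r.sum fun k c => c * fourierCoeff f (n - k) := by
  have hi : ∀ k : ℤ, Integrable (fun t => fourier k t * f t) haarT := fun k =>
    hf.bdd_mul (c := ‖fourier (T := 1) k‖) (fourier k).continuous.aestronglyMeasurable
      (ae_of_all _ fun t => (fourier k).norm_coe_le_norm t)
  rw [Polynomial.sum_def]
  simp only [fourierCoeff, smul_eq_mul, ← integral_const_mul]
  rw [← integral_finsetSum _ fun k _ => (hi _).const_mul _]
  congr 1
  ext t
  rw [Polynomial.eval_eq_sum, Polynomial.sum_def, Finset.sum_mul, Finset.mul_sum]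
  refine Finset.sum_congr rfl fun k _ => ?_
  have : fourier (-(n - k)) t = fourier (-n) t * (t.toCircle : ℂ) ^ k := by
    rw [show -(n - (k : ℤ)) = -n + k by ring, fourier_add]
    congr 1
    simp [AddCircle.toCircle_nsmul]
  rw [this]; ring

theorem fourierCoeff_eval (r : ℂ[X]) (n : ℤ) :
    fourierCoeff (fun t : UnitAddCircle => r.eval (t.toCircle : ℂ)) n
      = r.sum fun k c => if n = k then c else 0 := by
  have h := fourierCoeff_eval_mul r (f := fun _ => 1) (integrable_const _) n
  simp only [mul_one] at h
  rw [h, Polynomial.sum_def, Polynomial.sum_def]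
  refine Finset.sum_congr rfl fun k _ => ?_
  have h1 : fourierCoeff (fun _ : UnitAddCircle => (1 : ℂ)) (n - k) = if n = k then 1 else 0 := by
    have h2 := (orthonormal_iff_ite.1 (orthonormal_fourier (T := 1))) (n - k) 0
    simp only [sub_eq_zero] at h2
    rw [← h2, MeasureTheory.L2.inner_def, fourierCoeff]
    refine integral_congr_ae ?_
    filter_upwards [coeFn_fourierLp (T := 1) 2 (n - k), coeFn_fourierLp (T := 1) 2 0] with t h3 h4
    rw [h3, h4, fourier_neg]
    simp
  rw [h1]; split_ifs <;> simp

theorem integrable_eval_mul (r : ℂ[X]) {f : UnitAddCircle → ℂ} (hf : Integrable f haarT) :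
    Integrable (fun t => r.eval (t.toCircle : ℂ) * f t) haarT :=
  hf.bdd_mul (c := ‖(⟨_, continuous_eval_circle r⟩ : C(UnitAddCircle, ℂ))‖)
    (continuous_eval_circle r).aestronglyMeasurable
    (ae_of_all _ fun t =>
      (⟨_, continuous_eval_circle r⟩ : C(UnitAddCircle, ℂ)).norm_coe_le_norm t)

theorem coeff_zero_of_lt {f : UnitAddCircle → ℂ} {α : ℂ} (hα : ‖α‖ = 1) (N : ℤ)
    (h : ∀ n < N, fourierCoeff f (n - 1) = α * fourierCoeff f n) :
    ∀ n < N, fourierCoeff f n = 0 := by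
  intro n hn
  have h1 : ∀ k : ℕ, ‖fourierCoeff f (n - k)‖ = ‖fourierCoeff f n‖ := by
    intro k
    induction k with
    | zero => simp
    | succ k ih =>
      rw [← ih, show n - ((k + 1 : ℕ) : ℤ) = n - k - 1 by push_cast; ring, h _ (by omega),
        norm_mul, hα, one_mul]
  have h2 : Tendsto (fun k : ℕ => ‖fourierCoeff f (n - k)‖) atTop (𝓝 0) := by
    have hinj : Function.Injective fun k : ℕ => n - (k : ℤ) := fun a b hab => by
      simpa using hab
    have := (tendsto_fourierCoeff (f := f)).comp hinj.tendsto_cofinite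
    rw [Nat.cofinite_eq_atTop] at this
    simpa using this.norm
  simp only [h1] at h2
  exact norm_eq_zero.1 (tendsto_nhds_unique tendsto_const_nhds h2)

theorem coeff_zero_of_le {f : UnitAddCircle → ℂ} {α : ℂ} (hα : ‖α‖ = 1) (N : ℤ)
    (h : ∀ n, N + 1 ≤ n → fourierCoeff f (n - 1) = α * fourierCoeff f n) :
    ∀ n, N ≤ n → fourierCoeff f n = 0 := by
  intro n hn
  have h1 : ∀ k : ℕ, ‖fourierCoeff f (n + k)‖ = ‖fourierCoeff f n‖ := by
    intro k
    induction k with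
    | zero => simp
    | succ k ih =>
      have h3 := h (n + k + 1) (by omega)
      rw [add_sub_cancel_right] at h3
      rw [← ih, h3, norm_mul, hα, one_mul]
      push_cast
      rw [add_assoc]
  have h2 : Tendsto (fun k : ℕ => ‖fourierCoeff f (n + k)‖) atTop (𝓝 0) := by
    have hinj : Function.Injective fun k : ℕ => n + (k : ℤ) := fun a b hab => by
      simpa using hab
    have := (tendsto_fourierCoeff (f := f)).comp hinj.tendsto_cofinite
    rw [Nat.cofinite_eq_atTop] at this
    simpa using this.norm
  simp only [h1] at h2
  exact norm_eq_zero.1 (tendsto_nhds_unique tendsto_const_nhds h2)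

/-- Division by a polynomial with all its roots on the circle preserves the vanishing of
Fourier coefficients. -/
theorem coeff_zero_of_eval_mul (d : ℕ) : ∀ (q : ℂ[X]), q ≠ 0 → q.natDegree = d →
    (∀ z, q.IsRoot z → ‖z‖ = 1) → ∀ {f : UnitAddCircle → ℂ}, Integrable f haarT → ∀ N : ℤ,
    ((∀ n < N, fourierCoeff (fun t => q.eval (t.toCircle : ℂ) * f t) n = 0) →
      ∀ n < N, fourierCoeff f n = 0) ∧
    ((∀ n, N + d ≤ n → fourierCoeff (fun t => q.eval (t.toCircle : ℂ) * f t) n = 0) →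
      ∀ n, N ≤ n → fourierCoeff f n = 0) := by
  induction d with
  | zero =>
    intro q hq hd hr f hf N
    rw [eq_C_of_natDegree_eq_zero hd] at hq ⊢
    have hc : q.coeff 0 ≠ 0 := fun h => hq (by rw [h, C_0])
    simp only [eval_C, fourierCoeff.const_mul, mul_eq_zero, hc, false_or]
    exact ⟨fun h => h, fun h n hn => h n (by simpa using hn)⟩
  | succ d ih =>
    intro q hq hd hr f hf N
    obtain ⟨α, hα⟩ := IsAlgClosed.exists_root q (by
      rw [degree_eq_natDegree hq, hd]; exact_mod_cast Nat.succ_ne_zero d)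
    obtain ⟨q', rfl⟩ := dvd_iff_isRoot.2 hα
    have hq' : q' ≠ 0 := right_ne_zero_of_mul hq
    have hd' : q'.natDegree = d := by
      rw [natDegree_mul (X_sub_C_ne_zero α) hq', natDegree_X_sub_C] at hd; omega
    have hr' : ∀ z, q'.IsRoot z → ‖z‖ = 1 := fun z hz => hr z (hz.dvd (dvd_mul_left _ _))
    have hα1 := hr α hα
    have hf' := integrable_eval_mul q' hf
    have key : ∀ n, fourierCoeff
        (fun t => ((X - C α) * q').eval (t.toCircle : ℂ) * f t) n
        = fourierCoeff (fun t => q'.eval (t.toCircle : ℂ) * f t) (n - 1)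
          - α * fourierCoeff (fun t => q'.eval (t.toCircle : ℂ) * f t) n := by
      intro n
      rw [← fourierCoeff_sub_root hf']
      simp [mul_assoc]
    simp only [key, sub_eq_zero]
    obtain ⟨ih1, ih2⟩ := ih q' hq' hd' hr' hf N
    refine ⟨fun h => ih1 (coeff_zero_of_lt hα1 N h), fun h => ih2 ?_⟩
    refine coeff_zero_of_le hα1 (N + d) fun n hn => h n ?_
    push_cast; omega


/-! ### Rational functions -/

/-- The poles of a rational function in `ℂ`, with multiplicities. -/
def poles (R : RatFunc ℂ) : Multiset ℂ := R.denom.roots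

/-- The zeroes of a nonzero rational function in `ℂ`, with multiplicities. -/
def zeroes (R : RatFunc ℂ) : Multiset ℂ := R.num.roots

/-- The rational functions all of whose poles lie on the unit circle. -/
def ratT : Set (RatFunc ℂ) := {R | ∀ z ∈ poles R, ‖z‖ = 1}

/-- The strictly proper rational functions all of whose poles lie on the unit circle. -/
def ratZeroT : Submodule ℂ (RatFunc ℂ) where
  carrier := {ρ | ∃ a b : ℂ[X], b ≠ 0 ∧ (∀ z, b.IsRoot z → ‖z‖ = 1) ∧ a.degree < b.degree ∧
    ρ = algebraMap ℂ[X] (RatFunc ℂ) a / algebraMap ℂ[X] (RatFunc ℂ) b}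
  add_mem' := by
    rintro _ _ ⟨a, b, hb, hbr, hab, rfl⟩ ⟨c, d, hd, hdr, hcd, rfl⟩
    refine ⟨a * d + b * c, b * d, mul_ne_zero hb hd, fun z hz => ?_, ?_, ?_⟩
    · rcases root_mul.1 hz with h | h
      exacts [hbr z h, hdr z h]
    · refine lt_of_le_of_lt (degree_add_le _ _) (max_lt ?_ ?_)
      · rw [degree_mul, degree_mul]
        exact WithBot.add_lt_add_right (degree_ne_bot.2 hd) hab
      · rw [degree_mul, degree_mul]
        exact WithBot.add_lt_add_left (degree_ne_bot.2 hb) hcd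
    · rw [div_add_div _ _ (RatFunc.algebraMap_ne_zero hb) (RatFunc.algebraMap_ne_zero hd)]
      simp
  zero_mem' := ⟨0, 1, one_ne_zero, fun z hz => by simp at hz, by simp, by simp⟩
  smul_mem' := by
    rintro c _ ⟨a, b, hb, hbr, hab, rfl⟩
    refine ⟨c • a, b, hb, hbr, (degree_smul_le c a).trans_lt hab, ?_⟩
    rw [RatFunc.smul_eq_C_mul, Polynomial.smul_eq_C_mul, map_mul, RatFunc.algebraMap_C,
      mul_div_assoc]

/-- `𝒫_n`: the polynomials of degree at most `n`; this is `{0}` for `n < 0`. -/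
def polyLE (n : ℤ) : Submodule ℂ ℂ[X] where
  carrier := {r | ∀ k : ℕ, n < k → r.coeff k = 0}
  add_mem' := by
    intro a b ha hb k hk
    rw [coeff_add, ha k hk, hb k hk, add_zero]
  zero_mem' := fun k _ => coeff_zero k
  smul_mem' := by
    intro c a ha k hk
    rw [coeff_smul, ha k hk, smul_zero]

/-- The space of polynomials `r` such that `r q = r₁ s + r₂` for some
`r₁, r₂ ∈ 𝒫_{deg q - 1}`. -/
def tildeP (s q : ℂ[X]) : Submodule ℂ ℂ[X] where
  carrier := {r | ∃ r₁ ∈ polyLE (q.natDegree - 1), ∃ r₂ ∈ polyLE (q.natDegree - 1),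
    r * q = r₁ * s + r₂}
  add_mem' := by
    rintro a b ⟨a₁, ha₁, a₂, ha₂, ha⟩ ⟨b₁, hb₁, b₂, hb₂, hb⟩
    exact ⟨_, add_mem ha₁ hb₁, _, add_mem ha₂ hb₂, by rw [add_mul, ha, hb]; ring⟩
  zero_mem' := ⟨0, zero_mem _, 0, zero_mem _, by simp⟩
  smul_mem' := by
    rintro c a ⟨a₁, ha₁, a₂, ha₂, ha⟩
    exact ⟨_, Submodule.smul_mem _ c ha₁, _, Submodule.smul_mem _ c ha₂, by
      rw [smul_mul_assoc, ha, smul_add, smul_mul_assoc]⟩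

/-- A polynomial as an element of `H^p`. -/
def polyHp (p : ℝ≥0∞) [Fact (1 ≤ p)] : ℂ[X] →ₗ[ℂ] Hp p where
  toFun r := ⟨ContinuousMap.toLp p haarT ℂ ⟨_, continuous_eval_circle r⟩, by
    intro n hn
    rw [fourierCoeff_congr_ae (ContinuousMap.coeFn_toLp haarT _)]
    refine (fourierCoeff_eval r n).trans ?_
    rw [Polynomial.sum_def]
    refine Finset.sum_eq_zero fun k _ => if_neg ?_
    rintro rfl
    exact hn (Int.natCast_nonneg k)⟩
  map_add' r₁ r₂ := by
    refine Subtype.ext ?_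
    simp only [Submodule.coe_add]
    rw [← map_add]
    congr 1
    ext t
    simp
  map_smul' c r := by
    refine Subtype.ext ?_
    simp only [Submodule.coe_smul, RingHom.id_apply]
    rw [← map_smul]
    congr 1
    ext t
    simp

/-! ### The Toeplitz-like operator -/

/-- The graph of `T_ω`: the pairs `(g, ℙ f)` with `g ∈ H^p` and `ω g = f + ρ`, where `f ∈ L^p`
and `ρ` is strictly proper with all its poles on the circle. -/
def toeplitzGraph (p : ℝ≥0∞) [Fact (1 ≤ p)] (ω : RatFunc ℂ) : Submodule ℂ (Hp p × Hp p) where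
  carrier := {x | ∃ f : LpT p, ∃ ρ ∈ ratZeroT,
    bd ω * toL0 x.1 = (f : L0T) + bd ρ ∧ IsRieszProjection f x.2}
  add_mem' := by
    rintro ⟨g₁, h₁⟩ ⟨g₂, h₂⟩ ⟨f₁, ρ₁, hρ₁, e₁, P₁⟩ ⟨f₂, ρ₂, hρ₂, e₂, P₂⟩
    refine ⟨f₁ + f₂, ρ₁ + ρ₂, add_mem hρ₁ hρ₂, ?_, ?_⟩
    · have : toL0 (g₁ + g₂) = toL0 g₁ + toL0 g₂ := rfl
      simp only [Prod.mk_add_mk] at *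
      rw [this, L0_mul_add, e₁, e₂, bd_add, AddSubgroup.coe_add]
      abel
    · have := add_mem P₁ P₂
      rw [IsRieszProjection]
      convert this using 1
      simp only [Prod.mk_add_mk, Submodule.coe_add]
      abel
  zero_mem' := by
    refine ⟨0, 0, zero_mem _, ?_, ?_⟩
    · have : toL0 (0 : Hp p) = 0 := rfl
      simp only [Prod.fst_zero]
      rw [this, L0_mul_zero, bd_zero]
      simp
    · simp [IsRieszProjection]
  smul_mem' := by
    rintro c ⟨g, h⟩ ⟨f, ρ, hρ, e, P⟩
    refine ⟨c • f, c • ρ, Submodule.smul_mem _ c hρ, ?_, ?_⟩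
    · have : toL0 (c • g) = c • toL0 g := rfl
      simp only [Prod.smul_mk] at *
      rw [this, L0_mul_smul, e, bd_smul, smul_add]
      rfl
    · have := Submodule.smul_mem _ c P
      rw [IsRieszProjection]
      convert this using 1
      simp only [Prod.smul_mk, Submodule.coe_smul, smul_sub]

/-- The Toeplitz-like operator `T_ω (H^p → H^p)`. -/
def toeplitz (p : ℝ≥0∞) [Fact (1 ≤ p)] (ω : RatFunc ℂ) : Hp p →ₗ.[ℂ] Hp p :=
  (toeplitzGraph p ω).toLinearPMap

theorem toeplitzGraph_single_valued (p : ℝ≥0∞) [Fact (1 ≤ p)] (ω : RatFunc ℂ) :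
    ∀ x ∈ toeplitzGraph p ω, x.1 = 0 → x.2 = 0 := by
  rintro ⟨g, h⟩ ⟨f, ρ, ⟨a, b, hb, hbr, hab, rfl⟩, e, P⟩ (rfl : g = 0)
  have h0 : toL0 (0 : Hp p) = 0 := rfl
  simp only [h0, L0_mul_zero] at e
  have hbf : (fun t => b.eval (t.toCircle : ℂ) * (f : UnitAddCircle → ℂ) t)
      =ᵐ[haarT] fun t => (-a).eval (t.toCircle : ℂ) := by
    have e' : ((f : L0T) + bd (algebraMap ℂ[X] (RatFunc ℂ) a / algebraMap ℂ[X] (RatFunc ℂ) b) :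
        L0T) =ᵐ[haarT] (0 : L0T) := by rw [← e]
    filter_upwards [e', AEEqFun.coeFn_add (f : L0T) (bd (algebraMap ℂ[X] (RatFunc ℂ) a /
      algebraMap ℂ[X] (RatFunc ℂ) b)), coeFn_bd_div a b, AEEqFun.coeFn_zero (μ := haarT) (β := ℂ),
      ae_eval_ne_zero hb] with t h1 h2 h3 h4 h5
    rw [h1, h4, Pi.add_apply, h3, Pi.zero_apply] at h2
    have h6 : (f : UnitAddCircle → ℂ) t
        = -(a.eval (t.toCircle : ℂ) / b.eval (t.toCircle : ℂ)) := by
      linear_combination -h2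
    rw [h6, eval_neg]
    field_simp
  have hcoef : ∀ n : ℤ, (n < 0 ∨ (b.natDegree : ℤ) ≤ n) →
      fourierCoeff (fun t => b.eval (t.toCircle : ℂ) * (f : UnitAddCircle → ℂ) t) n = 0 := by
    intro n hn
    rw [fourierCoeff_congr_ae hbf, fourierCoeff_eval, Polynomial.sum_def]
    refine Finset.sum_eq_zero fun k hk => if_neg ?_
    rintro rfl
    have hk' := le_natDegree_of_mem_supp k hk
    rw [natDegree_neg] at hk'
    have ha : a ≠ 0 := by rintro rfl; simp at hk
    have := natDegree_lt_natDegree ha hab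
    omega
  have hf := integrable_LpT f
  obtain ⟨-, h2⟩ := coeff_zero_of_eval_mul _ b hb rfl hbr hf 0
  obtain ⟨h1, -⟩ := coeff_zero_of_eval_mul _ b hb rfl hbr hf 0
  have hz : ∀ n, fourierCoeff (f : UnitAddCircle → ℂ) n = 0 := by
    intro n
    rcases lt_or_ge n 0 with hn | hn
    · exact h1 (fun m hm => hcoef m (Or.inl hm)) n hn
    · exact h2 (fun m hm => hcoef m (Or.inr (by omega))) n hn
  have hhz : ∀ n, fourierCoeff ((h : LpT p) : UnitAddCircle → ℂ) n = 0 := by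
    intro n
    rcases lt_or_ge n 0 with hn | hn
    · exact h.2 n (by simpa using hn)
    · have h3 := P n (by simpa using hn)
      have h4 : (h : LpT p) = f + (-1 : ℂ) • (f - (h : LpT p)) := by
        simp
      rw [h4, fourierCoeff_Lp_add, fourierCoeff_Lp_smul, hz, h3]
      simp
  refine Subtype.ext (Lp.ext ?_)
  exact (ae_zero_of_fourierCoeff (integrable_LpT _) hhz).trans (Lp.coeFn_zero _ _ _).symm

/-- `T_ω` is well defined: its graph is `toeplitzGraph p ω`. -/
theorem toeplitz_graph (p : ℝ≥0∞) [Fact (1 ≤ p)] (ω : RatFunc ℂ) :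
    (toeplitz p ω).graph = toeplitzGraph p ω :=
  Submodule.toLinearPMap_graph_eq _ (toeplitzGraph_single_valued p ω)

/-- If all poles of `ω` lie on the circle, then the function `f` in `ω g = f + ρ` has a Riesz
projection, so that `Dom(T_ω)` is described by the existence of `f` and `ρ` alone. -/
theorem mem_toeplitz_domain_iff (p : ℝ≥0∞) [Fact (1 ≤ p)] {ω : RatFunc ℂ} (hω : ω ∈ ratT)
    (g : Hp p) : g ∈ (toeplitz p ω).domain ↔
      ∃ f : LpT p, ∃ ρ ∈ ratZeroT, bd ω * toL0 g = (f : L0T) + bd ρ := by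
  rw [toeplitz, Submodule.toLinearPMap_domain]
  constructor
  · rintro ⟨⟨g', h⟩, ⟨f, ρ, hρ, e, -⟩, rfl⟩
    exact ⟨f, ρ, hρ, e⟩
  rintro ⟨f, _, ⟨a, b, hb, hbr, hab, rfl⟩, e⟩
  suffices hfH : f ∈ Hp p by
    exact ⟨(g, ⟨f, hfH⟩), ⟨f, _, ⟨a, b, hb, hbr, hab, rfl⟩, e, by simp [IsRieszProjection]⟩, rfl⟩
  have hd := RatFunc.denom_ne_zero ω
  have hf := integrable_LpT f
  have hg := integrable_LpT (g : LpT p)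
  have hdb : ∀ z, (ω.denom * b).IsRoot z → ‖z‖ = 1 := by
    intro z hz
    rcases root_mul.1 hz with h | h
    · exact hω z ((mem_roots hd).2 h)
    · exact hbr z h
  have hae : (fun t => (ω.denom * b).eval (t.toCircle : ℂ) * (f : UnitAddCircle → ℂ) t)
      =ᵐ[haarT] fun t => (ω.num * b).eval (t.toCircle : ℂ) * ((g : LpT p) : UnitAddCircle → ℂ) t
        + (-1 : ℂ) * (a * ω.denom).eval (t.toCircle : ℂ) := by
    have e' : (bd ω * toL0 g : L0T) =ᵐ[haarT] ((f : L0T) + bd (algebraMap ℂ[X] (RatFunc ℂ) a /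
        algebraMap ℂ[X] (RatFunc ℂ) b) : L0T) := by rw [← e]
    have e2 := coeFn_bd_div ω.num ω.denom
    rw [RatFunc.num_div_denom] at e2
    filter_upwards [e', e2, AEEqFun.coeFn_mul (bd ω) (toL0 g),
      AEEqFun.coeFn_add (f : L0T) (bd (algebraMap ℂ[X] (RatFunc ℂ) a /
      algebraMap ℂ[X] (RatFunc ℂ) b)), coeFn_bd_div a b, ae_eval_ne_zero hb,
      ae_eval_ne_zero hd] with t h1 h2 h3 h4 h5 h6 h7
    rw [h3, h4, Pi.mul_apply, Pi.add_apply, h2, h5] at h1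
    simp only [eval_mul]
    rw [div_mul_eq_mul_div, div_eq_iff h7] at h1
    have h8 : a.eval (t.toCircle : ℂ) / b.eval (t.toCircle : ℂ) * b.eval (t.toCircle : ℂ)
      = a.eval (t.toCircle : ℂ) := div_mul_cancel₀ _ h6
    linear_combination (-b.eval (t.toCircle : ℂ)) * h1 - ω.denom.eval (t.toCircle : ℂ) * h8
  have hN := (coeff_zero_of_eval_mul _ (ω.denom * b) (mul_ne_zero hd hb) rfl hdb hf 0).1
  intro n hn
  refine hN (fun m hm => ?_) n (by simpa using hn)
  have hci : Integrable (fun t : UnitAddCircle => (a * ω.denom).eval (t.toCircle : ℂ)) haarT := by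
    simpa using integrable_eval_mul (a * ω.denom) (f := fun _ => 1) (integrable_const _)
  rw [fourierCoeff_congr_ae hae]
  have hadd := fourierCoeff.add (integrable_eval_mul (ω.num * b) hg) (hci.const_mul (-1 : ℂ))
  have hadd' := congrFun hadd m
  refine hadd'.trans ?_
  rw [Pi.add_apply, fourierCoeff.const_mul, fourierCoeff_eval, fourierCoeff_eval_mul _ hg,
    Polynomial.sum_def, Polynomial.sum_def]
  rw [Finset.sum_eq_zero, Finset.sum_eq_zero]
  · simp
  · intro k _
    exact if_neg (by omega)
  · intro k _
    rw [g.2 (m - k) (by simp; omega), mul_zero]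

end RationalToeplitz

/-! ### Unbounded Fredholm operators -/

namespace LinearPMap

variable {E F : Type*} [NormedAddCommGroup E] [NormedSpace ℂ E] [NormedAddCommGroup F]
  [NormedSpace ℂ F]

/-- The kernel of an unbounded operator, as a subspace of the ambient space. -/
def kernel (T : E →ₗ.[ℂ] F) : Submodule ℂ E := (LinearMap.ker T.toFun).map T.domain.subtype

/-- The range of an unbounded operator. -/
def ran (T : E →ₗ.[ℂ] F) : Submodule ℂ F := LinearMap.range T.toFun

/-- A closed operator with a finite dimensional kernel and whose range has a finite dimensional
complement. -/
structure IsFredholm (T : E →ₗ.[ℂ] F) : Prop where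
  isClosed : T.IsClosed
  finite_kernel : FiniteDimensional ℂ T.kernel
  finite_complement : ∃ C : Submodule ℂ F, IsCompl T.ran C ∧ FiniteDimensional ℂ C

/-- The Fredholm index: the dimension of the kernel minus the dimension of a complement of the
range (every complement of the range is isomorphic to the quotient by the range). -/
def fredholmIndex (T : E →ₗ.[ℂ] F) : ℤ :=
  (Module.finrank ℂ T.kernel : ℤ) - Module.finrank ℂ (F ⧸ T.ran)

end LinearPMap

end

open RationalToeplitz

/-! Clearing denominators turns the theorem into algebra over `ℂ[X]`. By `mem_toeplitzGraph_iff`,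
`T_ω g = h` holds exactly when `s g = q h + r` for a polynomial `r` of degree less than `deg q`. The
analytic input is that Fourier coefficients tend to zero: dividing by a polynomial with all its
roots on the circle then creates no new coefficients at either end. Hence the `f` in `ω g = f + ρ`
already lies in `H^p`, and `q ρ` is a polynomial.

What remains is division in the `ℂ[X]`-module `H^p`, one linear factor at a time. If `|α| > 1`, then
`X - α` maps `H^p` onto itself (`exists_X_sub_C_smul_eq`). If `|α| < 1`, every element of `H^p` is a
multiple of `X - α` plus a constant (`exists_X_sub_C_smul_add_eq`). If `|α| ≤ 1`, no nonzero
constant is such a multiple (`C_eq_zero_of_X_sub_C_smul`), so division by a polynomial with roots in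
the closed disc takes polynomials to polynomials. Bézout and Euclidean division then give the
domain, range, kernel and complement; the index is a count of degrees.

If `s` vanishes at `α` on the circle, the range lies in `(X - α) H^p + ℂ`. A finite dimensional
complement would make `(X - α) H^p` closed of finite codimension, so multiplication by `X - α` would
be bounded below on `H^p`. Multiplication by powers of `X` and density carry the bound to `L^p`,
where indicators of small arcs around `α` violate it. -/

noncomputable section

namespace RationalToeplitz

/-! ### Multiplication operators and the `ℂ[X]`-module structures -/

/-- The restriction of a polynomial to the circle as a continuous function. -/
def evalC (r : ℂ[X]) : C(UnitAddCircle, ℂ) := ⟨_, continuous_eval_circle r⟩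

variable {p : ℝ≥0∞} [Fact (1 ≤ p)]

omit [Fact (1 ≤ p)] in
theorem memLp_continuous_mul (φ : C(UnitAddCircle, ℂ)) (f : LpT p) :
    MemLp (fun t => φ t * f t) p haarT :=
  (Lp.memLp f).of_le_mul (φ.continuous.aestronglyMeasurable.mul (Lp.aestronglyMeasurable f))
    (ae_of_all _ fun t => by
      rw [norm_mul]; exact mul_le_mul_of_nonneg_right (φ.norm_coe_le_norm t) (norm_nonneg _))

/-- Multiplication by a continuous function on `L^p`. -/
def mulC (φ : C(UnitAddCircle, ℂ)) : LpT p →L[ℂ] LpT p :=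
  have hm := memLp_continuous_mul φ
  LinearMap.mkContinuous
    { toFun := fun f => (hm f).toLp _
      map_add' := fun f g => by
        refine Lp.ext ?_
        filter_upwards [(hm (f + g)).coeFn_toLp, (hm f).coeFn_toLp, (hm g).coeFn_toLp,
          Lp.coeFn_add f g, Lp.coeFn_add ((hm f).toLp _) ((hm g).toLp _)] with t h1 h2 h3 h4 h5
        rw [h1, h5, Pi.add_apply, h2, h3, h4, Pi.add_apply, mul_add]
      map_smul' := fun c f => by
        refine Lp.ext ?_
        filter_upwards [(hm (c • f)).coeFn_toLp, (hm f).coeFn_toLp, Lp.coeFn_smul c f,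
          Lp.coeFn_smul c ((hm f).toLp _)] with t h1 h2 h3 h4
        rw [h1, RingHom.id_apply, h4, Pi.smul_apply, h2, h3, Pi.smul_apply, smul_eq_mul,
          smul_eq_mul, mul_left_comm] }
    ‖φ‖ fun f => by
      refine Lp.norm_le_mul_norm_of_ae_le_mul ?_
      filter_upwards [(hm f).coeFn_toLp] with t h1
      simp only [LinearMap.coe_mk, AddHom.coe_mk]
      rw [h1, norm_mul]
      exact mul_le_mul_of_nonneg_right (φ.norm_coe_le_norm t) (norm_nonneg _)

theorem coeFn_mulC (φ : C(UnitAddCircle, ℂ)) (f : LpT p) :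
    (mulC φ f : UnitAddCircle → ℂ) =ᵐ[haarT] fun t => φ t * f t :=
  (memLp_continuous_mul φ f).coeFn_toLp

/-- With polynomials as scalars, identities such as `s g = q h + r` can be manipulated linearly, and
polynomial multipliers commute. -/
instance : Module ℂ[X] (LpT p) where
  smul r f := mulC (evalC r) f
  one_smul f := by
    refine Lp.ext ((coeFn_mulC _ _).trans (ae_of_all _ fun t => ?_))
    simp [evalC]
  mul_smul r s f := by
    refine Lp.ext ?_
    filter_upwards [coeFn_mulC (evalC (r * s)) f, coeFn_mulC (evalC r) (mulC (evalC s) f),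
      coeFn_mulC (evalC s) f] with t h1 h2 h3
    refine h1.trans (Eq.trans ?_ h2.symm)
    rw [h3]
    simp [evalC, mul_assoc]
  smul_zero r := map_zero (mulC (evalC r))
  smul_add r := map_add (mulC (evalC r))
  add_smul r s f := by
    refine Lp.ext ?_
    filter_upwards [coeFn_mulC (evalC (r + s)) f, coeFn_mulC (evalC r) f,
      coeFn_mulC (evalC s) f, Lp.coeFn_add (mulC (evalC r) f) (mulC (evalC s) f)] with t h1 h2 h3 h4
    refine h1.trans (Eq.trans ?_ h4.symm)
    rw [Pi.add_apply, h2, h3]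
    simp [evalC, add_mul]
  zero_smul f := by
    refine Lp.ext ?_
    filter_upwards [coeFn_mulC (evalC 0) f, Lp.coeFn_zero ℂ p haarT] with t h1 h2
    refine h1.trans (Eq.trans ?_ h2.symm)
    simp [evalC]

theorem coeFn_polySmul (r : ℂ[X]) (f : LpT p) :
    (r • f : LpT p) =ᵐ[haarT] fun t => r.eval (t.toCircle : ℂ) * f t :=
  coeFn_mulC _ _

theorem mulC_evalC (r : ℂ[X]) (f : LpT p) : mulC (evalC r) f = r • f := rfl

theorem fourierCoeff_polySmul (r : ℂ[X]) (f : LpT p) (n : ℤ) :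
    fourierCoeff (r • f : LpT p) n = r.sum fun k c => c * fourierCoeff f (n - k) := by
  rw [fourierCoeff_congr_ae (coeFn_polySmul r f), fourierCoeff_eval_mul r (integrable_LpT f)]

theorem fourierCoeff_X_sub_C_smul (α : ℂ) (f : LpT p) (n : ℤ) :
    fourierCoeff ((X - C α) • f : LpT p) n
      = fourierCoeff f (n - 1) - α * fourierCoeff f n := by
  rw [fourierCoeff_congr_ae (coeFn_polySmul _ f), ← fourierCoeff_sub_root (integrable_LpT f)]
  simp

omit [Fact (1 ≤ p)] in
theorem fourierCoeff_Lp_zero (n : ℤ) : fourierCoeff (0 : LpT p) n = 0 := by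
  rw [fourierCoeff_congr_ae (Lp.coeFn_zero _ _ _)]
  simp [fourierCoeff]

theorem fourierCoeff_Lp_neg (f : LpT p) (n : ℤ) :
    fourierCoeff (-f : LpT p) n = -fourierCoeff f n := by
  rw [← neg_one_smul ℂ f, fourierCoeff_Lp_smul, neg_one_mul]

theorem fourierCoeff_Lp_sub (f g : LpT p) (n : ℤ) :
    fourierCoeff (f - g : LpT p) n = fourierCoeff f n - fourierCoeff g n := by
  rw [sub_eq_add_neg, fourierCoeff_Lp_add, fourierCoeff_Lp_neg, sub_eq_add_neg]

theorem Lp_eq_of_fourierCoeff {f g : LpT p} (h : ∀ n, fourierCoeff f n = fourierCoeff g n) :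
    f = g := by
  rw [← sub_eq_zero]
  refine Lp.ext ((ae_zero_of_fourierCoeff (integrable_LpT _) fun n => ?_).trans
    (Lp.coeFn_zero _ _ _).symm)
  rw [fourierCoeff_Lp_sub, h, sub_self]

/-- A nonzero polynomial acts injectively on `L^p`. -/
theorem Lp_polySmul_cancel {r : ℂ[X]} (hr : r ≠ 0) {f g : LpT p} (h : r • f = r • g) : f = g := by
  refine Lp.ext ?_
  have h' : (r • f : LpT p) =ᵐ[haarT] (r • g : LpT p) := by rw [h]
  filter_upwards [h', coeFn_polySmul r f, coeFn_polySmul r g, ae_eval_ne_zero hr]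
    with t h0 h1 h2 h3
  rw [h1, h2] at h0
  exact mul_left_cancel₀ h3 h0

instance : Module ℂ[X] (Hp p) where
  smul r h := ⟨r • (h : LpT p), fun n hn => by
    rw [fourierCoeff_polySmul, Polynomial.sum_def]
    refine Finset.sum_eq_zero fun k _ => ?_
    simp only [Set.mem_ofPred_eq, not_le] at hn
    rw [h.2 (n - k) (by simp only [Set.mem_ofPred_eq]; omega), mul_zero]⟩
  one_smul h := Subtype.ext (one_smul ℂ[X] (h : LpT p))
  mul_smul r s h := Subtype.ext (mul_smul r s (h : LpT p))
  smul_zero r := Subtype.ext (smul_zero r)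
  smul_add r f g := Subtype.ext (smul_add r (f : LpT p) g)
  add_smul r s h := Subtype.ext (add_smul r s (h : LpT p))
  zero_smul h := Subtype.ext (zero_smul ℂ[X] (h : LpT p))

theorem coe_polySmul (r : ℂ[X]) (h : Hp p) : ((r • h : Hp p) : LpT p) = r • (h : LpT p) := rfl

theorem polySmul_cancel {r : ℂ[X]} (hr : r ≠ 0) {f g : Hp p} (h : r • f = r • g) : f = g :=
  Subtype.ext (Lp_polySmul_cancel hr (congrArg Subtype.val h))

/-- Multiplication by a polynomial as a bounded operator on `H^p`. -/
def mulHp (r : ℂ[X]) : Hp p →L[ℂ] Hp p :=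
  ((mulC (evalC r)).comp (Hp p).subtypeL).codRestrict (Hp p) fun h => (r • h).2

@[simp] theorem mulHp_apply (r : ℂ[X]) (h : Hp p) : mulHp r h = r • h := rfl

theorem toL0_smul (r : ℂ[X]) (h : Hp p) : toL0 (r • h) = bdPoly r * toL0 h := by
  refine AEEqFun.ext ?_
  filter_upwards [coeFn_polySmul r (h : LpT p), AEEqFun.coeFn_mul (bdPoly r) (toL0 h),
    coeFn_bdPoly r] with t h1 h2 h3
  rw [h2, Pi.mul_apply, h3]
  exact h1

theorem toL0_add (g h : Hp p) : toL0 (g + h) = toL0 g + toL0 h := rfl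

/-! ### Polynomials inside `H^p` -/

theorem coeFn_polyHp (r : ℂ[X]) :
    ((polyHp p r : LpT p) : UnitAddCircle → ℂ) =ᵐ[haarT] fun t => r.eval (t.toCircle : ℂ) :=
  ContinuousMap.coeFn_toLp haarT _

theorem toL0_polyHp (r : ℂ[X]) : toL0 (polyHp p r) = bdPoly r := by
  refine AEEqFun.ext ?_
  filter_upwards [coeFn_polyHp (p := p) r, coeFn_bdPoly r] with t h1 h2
  rw [h2]; exact h1

theorem smul_polyHp (r s : ℂ[X]) : r • polyHp p s = polyHp p (r * s) := by
  refine Subtype.ext (Lp.ext ?_)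
  filter_upwards [coeFn_polySmul r (polyHp p s : LpT p), coeFn_polyHp (p := p) s,
    coeFn_polyHp (p := p) (r * s)] with t h1 h2 h3
  rw [coe_polySmul, h1, h2, h3, eval_mul]

theorem fourierCoeff_polyHp (r : ℂ[X]) (n : ℤ) :
    fourierCoeff (polyHp p r : LpT p) n = if 0 ≤ n then r.coeff n.toNat else 0 := by
  rw [fourierCoeff_congr_ae (coeFn_polyHp r), fourierCoeff_eval, Polynomial.sum_def]
  split_ifs with hn
  · lift n to ℕ using hn
    simp only [Nat.cast_inj, Int.toNat_natCast]
    rw [Finset.sum_ite_eq]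
    split_ifs with h
    · rfl
    · exact (notMem_support_iff.1 h).symm
  · exact Finset.sum_eq_zero fun k _ => if_neg (by omega)

theorem polyHp_injective : Function.Injective (polyHp p) := by
  intro r s h
  ext k
  have := congrArg (fun f : Hp p => fourierCoeff (f : LpT p) (k : ℤ)) h
  simpa [fourierCoeff_polyHp] using this

theorem eq_polyHp_of_fourierCoeff {u : LpT p} {N : ℕ}
    (hneg : ∀ n < 0, fourierCoeff u n = 0) (hpos : ∀ n : ℤ, N ≤ n → fourierCoeff u n = 0) :
    ∃ r ∈ polyLE ((N : ℤ) - 1), u = polyHp p r := by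
  have hc : ∀ k, (∑ i ∈ Finset.range N, C (fourierCoeff u (i : ℤ)) * X ^ i).coeff k
      = if k < N then fourierCoeff u (k : ℤ) else 0 := by
    intro k
    simp only [finsetSum_coeff, coeff_C_mul, coeff_X_pow, mul_ite, mul_one, mul_zero]
    rw [Finset.sum_ite_eq]
    simp
  refine ⟨∑ i ∈ Finset.range N, C (fourierCoeff u (i : ℤ)) * X ^ i, fun k hk => ?_,
    Lp_eq_of_fourierCoeff fun n => ?_⟩
  · rw [hc, if_neg (by omega)]
  · rw [fourierCoeff_polyHp, hc]
    split_ifs with h1 h2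
    · rw [Int.toNat_of_nonneg h1]
    · exact hpos n (by omega)
    · exact hneg n (by omega)

/-! ### Continuity of Fourier coefficients and completeness of `H^p` -/

/-- The coefficient is bounded by the `L^1` norm, which on a probability space is at most the `L^p`
norm. -/
theorem norm_fourierCoeff_le (f : LpT p) (n : ℤ) : ‖fourierCoeff f n‖ ≤ ‖f‖ := by
  have h1 : ‖fourierCoeff f n‖ ≤ ∫ t, ‖f t‖ ∂haarT := by
    refine (norm_integral_le_integral_norm _).trans_eq (integral_congr_ae (ae_of_all _ fun t => ?_))
    simp only [norm_smul, fourier_apply, Circle.norm_coe, one_mul]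
  refine h1.trans ?_
  have h2 : ∫ t, ‖f t‖ ∂haarT = (eLpNorm f 1 haarT).toReal := by
    rw [eLpNorm_one_eq_lintegral_enorm, integral_norm_eq_lintegral_enorm
      (Lp.aestronglyMeasurable f)]
  rw [h2, Lp.norm_def]
  exact ENNReal.toReal_mono (Lp.eLpNorm_ne_top f)
    (eLpNorm_le_eLpNorm_of_exponent_le Fact.out (Lp.aestronglyMeasurable f))

/-- The `n`-th Fourier coefficient as a bounded functional on `L^p`. -/
def fourierCoeffL (n : ℤ) : LpT p →L[ℂ] ℂ :=
  LinearMap.mkContinuous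
    { toFun := fun f => fourierCoeff f n
      map_add' := fun f g => fourierCoeff_Lp_add f g n
      map_smul' := fun c f => fourierCoeff_Lp_smul c f n } 1
    fun f => by simpa using norm_fourierCoeff_le f n

theorem isClosed_Hp : IsClosed (Hp p : Set (LpT p)) := by
  have : (Hp p : Set (LpT p)) = ⋂ n : ℤ, ⋂ _ : n ∉ {n : ℤ | 0 ≤ n},
      ((fourierCoeffL (p := p) n).ker : Set (LpT p)) := by
    ext f
    simp only [Set.mem_iInter]
    rfl
  rw [this]
  exact isClosed_iInter fun n => isClosed_iInter fun _ => (fourierCoeffL n).isClosed_ker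

/-- Needed for the closed range argument when `s` has a zero on the circle. -/
instance : CompleteSpace (Hp p) := isClosed_Hp.completeSpace_coe

/-! ### Division by polynomials without roots on the circle -/

/-- Going down from `n`, the recurrence makes the moduli nondecreasing, while by Riemann–Lebesgue
they tend to zero. -/
theorem coeff_zero_of_recurrence_down {f : UnitAddCircle → ℂ} {α : ℂ} (hα : 1 ≤ ‖α‖)
    (h : ∀ n < 0, fourierCoeff f (n - 1) = α * fourierCoeff f n) :
    ∀ n < 0, fourierCoeff f n = 0 := by
  intro n hn
  have h1 : ∀ k : ℕ, ‖fourierCoeff f n‖ ≤ ‖fourierCoeff f (n - k)‖ := by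
    intro k
    induction k with
    | zero => simp
    | succ k ih =>
      rw [show n - ((k + 1 : ℕ) : ℤ) = n - k - 1 by push_cast; ring, h _ (by omega), norm_mul]
      exact ih.trans (le_mul_of_one_le_left (norm_nonneg _) hα)
  have hinj : Function.Injective fun k : ℕ => n - (k : ℤ) := fun a b hab => by simpa using hab
  have h2 := (tendsto_fourierCoeff (f := f)).comp hinj.tendsto_cofinite
  rw [Nat.cofinite_eq_atTop] at h2
  have h3 := ge_of_tendsto' h2.norm h1
  simpa using h3

/-- The mirror image: read upwards, the recurrence cannot decrease the moduli. -/
theorem coeff_zero_of_recurrence_up {f : UnitAddCircle → ℂ} {α : ℂ} (hα : ‖α‖ ≤ 1)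
    (h : ∀ n : ℤ, 1 ≤ n → fourierCoeff f (n - 1) = α * fourierCoeff f n) :
    ∀ n : ℤ, 0 ≤ n → fourierCoeff f n = 0 := by
  intro n hn
  have h1 : ∀ k : ℕ, ‖fourierCoeff f n‖ ≤ ‖fourierCoeff f (n + k)‖ := by
    intro k
    induction k with
    | zero => simp
    | succ k ih =>
      have h3 := h (n + k + 1) (by omega)
      rw [add_sub_cancel_right] at h3
      rw [h3, norm_mul] at ih
      push_cast
      rw [← add_assoc]
      exact ih.trans (mul_le_of_le_one_left (norm_nonneg _) hα)
  have hinj : Function.Injective fun k : ℕ => n + (k : ℤ) := fun a b hab => by simpa using hab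
  have h2 := (tendsto_fourierCoeff (f := f)).comp hinj.tendsto_cofinite
  rw [Nat.cofinite_eq_atTop] at h2
  have h3 := ge_of_tendsto' h2.norm h1
  simpa using h3

theorem exists_X_sub_C_smul_eq_Lp {α : ℂ} (hα : ‖α‖ ≠ 1) (f : LpT p) :
    ∃ g : LpT p, (X - C α) • g = f := by
  have hne : ∀ t : UnitAddCircle, (t.toCircle : ℂ) - α ≠ 0 := fun t ht => hα (by
    rw [← sub_eq_zero.1 ht, Circle.norm_coe])
  let φ : C(UnitAddCircle, ℂ) := ⟨fun t => ((t.toCircle : ℂ) - α)⁻¹,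
    ((continuous_subtype_val.comp AddCircle.continuous_toCircle).sub continuous_const).inv₀ hne⟩
  refine ⟨mulC φ f, Lp.ext ?_⟩
  filter_upwards [coeFn_polySmul (X - C α) (mulC φ f), coeFn_mulC φ f] with t h1 h2
  rw [h1, h2]
  simp only [eval_sub, eval_X, eval_C, ContinuousMap.coe_mk, φ]
  rw [mul_inv_cancel_left₀ (hne t)]

theorem fourierCoeff_C_smul (c : ℂ) (f : LpT p) (n : ℤ) :
    fourierCoeff (C c • f : LpT p) n = c * fourierCoeff f n := by
  rw [fourierCoeff_polySmul, sum_C_index (by simp)]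
  simp

/-- The quotient exists in `L^p`. Since `h` has no negative coefficients, those of the quotient
satisfy the downward recurrence and vanish. -/
theorem exists_X_sub_C_smul_eq {α : ℂ} (hα : 1 < ‖α‖) (h : Hp p) :
    ∃ g : Hp p, (X - C α) • g = h := by
  obtain ⟨g, hg⟩ := exists_X_sub_C_smul_eq_Lp hα.ne' (h : LpT p)
  refine ⟨⟨g, fun n hn => coeff_zero_of_recurrence_down hα.le (fun m hm => ?_) n
    (by simpa using hn)⟩, Subtype.ext hg⟩
  rw [← sub_eq_zero, ← fourierCoeff_X_sub_C_smul, hg]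
  exact h.2 m (by simpa using hm)

/-- On the circle `u = 1 / (X - α)` has coefficient `1` at index `-1`. Subtracting the right
multiple of `u` from the `L^p` quotient `v = h / (X - α)` kills the coefficient at `-1`, and the
recurrence then kills all those below; the correction costs only a constant in `h`. -/
theorem exists_X_sub_C_smul_add_eq {α : ℂ} (hα : ‖α‖ < 1) (h : Hp p) :
    ∃ g : Hp p, ∃ c : ℂ, h = (X - C α) • g + polyHp p (C c) := by
  obtain ⟨u, hu⟩ := exists_X_sub_C_smul_eq_Lp hα.ne (polyHp p 1 : LpT p)
  obtain ⟨v, hv⟩ := exists_X_sub_C_smul_eq_Lp hα.ne (h : LpT p)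
  have hu' : ∀ n, fourierCoeff u (n - 1) - α * fourierCoeff u n = if n = 0 then 1 else 0 := by
    intro n
    rw [← fourierCoeff_X_sub_C_smul, hu, fourierCoeff_polyHp]
    rcases lt_trichotomy n 0 with hn | rfl | hn
    · rw [if_neg (by omega), if_neg hn.ne]
    · simp
    · rw [if_pos hn.le, if_neg hn.ne', coeff_one, if_neg (by omega)]
  have hu0 : fourierCoeff u 0 = 0 := by
    refine coeff_zero_of_recurrence_up hα.le (fun n hn => ?_) 0 le_rfl
    rw [← sub_eq_zero, hu', if_neg (by omega)]
  have hu1 : fourierCoeff u (-1) = 1 := by simpa [hu0] using hu' 0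
  set c := fourierCoeff v (-1) with hc
  have hw : (X - C α) • (v - C c • u) = (h : LpT p) - polyHp p (C c) := by
    rw [smul_sub, hv, smul_comm, hu, ← coe_polySmul, smul_polyHp, mul_one]
  have hz : ∀ k : ℕ, fourierCoeff (v - C c • u : LpT p) (-1 - k) = 0 := by
    intro k
    induction k with
    | zero =>
      rw [Nat.cast_zero, sub_zero, fourierCoeff_Lp_sub, fourierCoeff_C_smul, hu1, mul_one, sub_self]
    | succ k ih =>
      have h1 := fourierCoeff_X_sub_C_smul α (v - C c • u) (-1 - k)
      rw [ih, hw, fourierCoeff_Lp_sub, h.2 _ (by simp only [Set.mem_ofPred_eq]; omega),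
        fourierCoeff_polyHp, if_neg (by omega), mul_zero, sub_zero, sub_zero] at h1
      rw [h1]
      congr 1
      push_cast
      ring
  refine ⟨⟨v - C c • u, fun n hn => ?_⟩, c, Subtype.ext ?_⟩
  · simp only [Set.mem_ofPred_eq, not_le] at hn
    have := hz (-1 - n).toNat
    rwa [Int.toNat_of_nonneg (by omega), sub_sub_cancel] at this
  · rw [Submodule.coe_add, coe_polySmul, hw, sub_add_cancel]

/-- Comparing coefficients at indices `n ≥ 1` gives the upward recurrence, so the constant term of
`g` vanishes; the coefficient at index `0` then reads `c = 0`. -/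
theorem C_eq_zero_of_X_sub_C_smul {α : ℂ} (hα : ‖α‖ ≤ 1) {g : Hp p} {c : ℂ}
    (h : (X - C α) • g = polyHp p (C c)) : c = 0 := by
  have hr : ∀ n, fourierCoeff (g : LpT p) (n - 1) - α * fourierCoeff (g : LpT p) n
      = if 0 ≤ n then (C c).coeff n.toNat else 0 := fun n => by
    rw [← fourierCoeff_X_sub_C_smul, ← coe_polySmul, h, fourierCoeff_polyHp]
  have h0 : fourierCoeff (g : LpT p) 0 = 0 := by
    refine coeff_zero_of_recurrence_up hα (fun n hn => ?_) 0 le_rfl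
    rw [← sub_eq_zero, hr, if_pos (by omega), coeff_C, if_neg (by omega)]
  have h1 : fourierCoeff (g : LpT p) (0 - 1) = 0 := g.2 _ (by simp)
  have := hr 0
  rw [h1, h0] at this
  simpa using this.symm

theorem exists_smul_eq_of_roots_outside (d : ℕ) : ∀ r : ℂ[X], r ≠ 0 → r.natDegree = d →
    (∀ z, r.IsRoot z → 1 < ‖z‖) → ∀ h : Hp p, ∃ g : Hp p, r • g = h := by
  induction d with
  | zero =>
    intro r hr hd _ h
    rw [eq_C_of_natDegree_eq_zero hd] at hr ⊢
    have hc : r.coeff 0 ≠ 0 := fun h0 => hr (by rw [h0, C_0])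
    refine ⟨C (r.coeff 0)⁻¹ • h, ?_⟩
    rw [← mul_smul, ← C_mul, mul_inv_cancel₀ hc, C_1, one_smul]
  | succ d ih =>
    intro r hr hd hroot h
    obtain ⟨α, hα⟩ := IsAlgClosed.exists_root r (by
      rw [degree_eq_natDegree hr, hd]; exact_mod_cast Nat.succ_ne_zero d)
    obtain ⟨r', rfl⟩ := dvd_iff_isRoot.2 hα
    have hr' : r' ≠ 0 := right_ne_zero_of_mul hr
    have hd' : r'.natDegree = d := by
      rw [natDegree_mul (X_sub_C_ne_zero α) hr', natDegree_X_sub_C] at hd; omega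
    obtain ⟨g, hg⟩ := exists_X_sub_C_smul_eq (hroot α hα) h
    obtain ⟨k, hk⟩ := ih r' hr' hd' (fun z hz => hroot z (hz.dvd (dvd_mul_left _ _))) g
    exact ⟨k, by rw [mul_smul, hk, hg]⟩

theorem mem_polyLE_of_degree_lt {r : ℂ[X]} {n : ℕ} (h : r.degree < n) : r ∈ polyLE ((n : ℤ) - 1) :=
  fun _ hk => coeff_eq_zero_of_degree_lt (h.trans_le (by exact_mod_cast by omega))

theorem degree_lt_of_mem_polyLE {r : ℂ[X]} {n : ℕ} (h : r ∈ polyLE ((n : ℤ) - 1)) :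
    r.degree < n :=
  (degree_lt_iff_coeff_zero _ _).2 fun m hm => h m (by omega)

/-- Division with remainder by a polynomial with all its roots in the disc: existence. -/
theorem exists_smul_add_polyHp_of_roots_inside (d : ℕ) : ∀ r : ℂ[X], r ≠ 0 → r.natDegree = d →
    (∀ z, r.IsRoot z → ‖z‖ < 1) → ∀ h : Hp p, ∃ g : Hp p, ∃ a : ℂ[X], a.degree < r.degree ∧
      h = r • g + polyHp p a := by
  induction d with
  | zero =>
    intro r hr hd _ h
    have hd' := hd
    rw [eq_C_of_natDegree_eq_zero hd] at hr ⊢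
    have hc : r.coeff 0 ≠ 0 := fun h0 => hr (by rw [h0, C_0])
    refine ⟨C (r.coeff 0)⁻¹ • h, 0, by simp [degree_C hc], ?_⟩
    rw [← mul_smul, ← C_mul, mul_inv_cancel₀ hc, C_1, one_smul, map_zero, add_zero]
  | succ d ih =>
    intro r hr hd hroot h
    obtain ⟨α, hα⟩ := IsAlgClosed.exists_root r (by
      rw [degree_eq_natDegree hr, hd]; exact_mod_cast Nat.succ_ne_zero d)
    obtain ⟨r', rfl⟩ := dvd_iff_isRoot.2 hα
    have hr' : r' ≠ 0 := right_ne_zero_of_mul hr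
    have hd' : r'.natDegree = d := by
      rw [natDegree_mul (X_sub_C_ne_zero α) hr', natDegree_X_sub_C] at hd; omega
    obtain ⟨g, c, hg⟩ := exists_X_sub_C_smul_add_eq (hroot α hα) h
    obtain ⟨k, a, ha, hk⟩ := ih r' hr' hd' (fun z hz => hroot z (hz.dvd (dvd_mul_left _ _))) g
    -- Substitute `g = r' k + a` into `h = (X - α) g + c`.
    refine ⟨k, (X - C α) * a + C c, ?_, ?_⟩
    · rw [degree_mul]
      refine (degree_add_le _ _).trans_lt (max_lt ?_ ?_)
      · rw [degree_mul, degree_X_sub_C]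
        exact WithBot.add_lt_add_left (by simp) ha
      · refine degree_C_le.trans_lt ?_
        rw [degree_X_sub_C, degree_eq_natDegree hr']
        exact_mod_cast by omega
    · rw [hg, hk, smul_add, ← mul_smul, smul_polyHp, map_add, add_assoc]

/-- Division by a polynomial with all its roots in the closed disc maps polynomials to
polynomials. -/
theorem exists_polyHp_of_smul_eq (d : ℕ) : ∀ r : ℂ[X], r ≠ 0 → r.natDegree = d →
    (∀ z, r.IsRoot z → ‖z‖ ≤ 1) → ∀ (g : Hp p) (a : ℂ[X]), r • g = polyHp p a →
      ∃ b, g = polyHp p b ∧ a = r * b := by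
  induction d with
  | zero =>
    intro r hr hd _ g a h
    rw [eq_C_of_natDegree_eq_zero hd] at hr h ⊢
    have hc : r.coeff 0 ≠ 0 := fun h0 => hr (by rw [h0, C_0])
    have h1 : C (r.coeff 0)⁻¹ * C (r.coeff 0) = (1 : ℂ[X]) := by
      rw [← C_mul, inv_mul_cancel₀ hc, C_1]
    refine ⟨C (r.coeff 0)⁻¹ * a, ?_, ?_⟩
    · rw [← smul_polyHp, ← h, ← mul_smul, h1, one_smul]
    · linear_combination (-a) * h1
  | succ d ih =>
    intro r hr hd hroot g a h
    obtain ⟨α, hα⟩ := IsAlgClosed.exists_root r (by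
      rw [degree_eq_natDegree hr, hd]; exact_mod_cast Nat.succ_ne_zero d)
    obtain ⟨r', rfl⟩ := dvd_iff_isRoot.2 hα
    have hr' : r' ≠ 0 := right_ne_zero_of_mul hr
    have hd' : r'.natDegree = d := by
      rw [natDegree_mul (X_sub_C_ne_zero α) hr', natDegree_X_sub_C] at hd; omega
    have ha := modByMonic_add_div a (X - C α)
    rw [modByMonic_X_sub_C_eq_C_eval] at ha
    set b := a /ₘ (X - C α)
    -- The remainder `a(α)` is a constant in `(X - α) H^p`, hence zero, and `X - α` can be
    -- cancelled.
    have h1 : (X - C α) • (r' • g - polyHp p b) = polyHp p (C (a.eval α)) := by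
      rw [smul_sub, ← mul_smul, h, smul_polyHp, ← map_sub, sub_eq_of_eq_add ha.symm]
    have h0 := C_eq_zero_of_X_sub_C_smul (hroot α hα) h1
    rw [h0, C_0] at h1 ha
    have h2 : r' • g = polyHp p b := by
      rw [← sub_eq_zero]
      refine polySmul_cancel (X_sub_C_ne_zero α) ?_
      rw [h1, map_zero, smul_zero]
    obtain ⟨e, he, hb⟩ := ih r' hr' hd' (fun z hz => hroot z (hz.dvd (dvd_mul_left _ _))) g b h2
    exact ⟨e, he, by rw [← ha, hb]; ring⟩

/-! ### The graph of the Toeplitz operator -/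

section Fractions

variable {ω : RatFunc ℂ} {s q : ℂ[X]} (hq : q ≠ 0) (hsq : IsCoprime s q)
  (hωsq : ω = algebraMap ℂ[X] (RatFunc ℂ) s / algebraMap ℂ[X] (RatFunc ℂ) q)
include hq hsq hωsq

/-- Coprime representations of one fraction differ by units, so poles and zeroes of `ω` can be read
off from `q` and `s`, although `q` need not be monic. -/
theorem associated_denom : Associated ω.denom q := by
  have h : ω.num * q = s * ω.denom := (RatFunc.num_mul_eq_mul_denom_iff hq).2 hωsq
  refine associated_of_dvd_dvd ?_ ?_
  · exact (RatFunc.isCoprime_num_denom ω).symm.dvd_of_dvd_mul_left ⟨s, by rw [h, mul_comm]⟩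
  · exact hsq.symm.dvd_of_dvd_mul_left ⟨ω.num, by rw [← h, mul_comm]⟩

theorem associated_num : Associated ω.num s := by
  have h : ω.num * q = s * ω.denom := (RatFunc.num_mul_eq_mul_denom_iff hq).2 hωsq
  refine associated_of_dvd_dvd ?_ ?_
  · exact (RatFunc.isCoprime_num_denom ω).dvd_of_dvd_mul_right ⟨q, h.symm⟩
  · exact hsq.dvd_of_dvd_mul_right ⟨ω.denom, h⟩

theorem norm_root_of_mem_ratT (hω : ω ∈ ratT) {z : ℂ} (hz : q.IsRoot z) : ‖z‖ = 1 :=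
  hω z ((mem_roots (RatFunc.denom_ne_zero ω)).2
    (hz.dvd (associated_denom hq hsq hωsq).symm.dvd))

end Fractions

theorem roots_eq_of_associated {a b : ℂ[X]} (h : Associated a b) : a.roots = b.roots := by
  obtain ⟨u, rfl⟩ := h
  obtain ⟨c, hc, hu⟩ := Polynomial.isUnit_iff.1 u.isUnit
  rw [← hu, mul_comm, roots_C_mul _ hc.ne_zero]

/-- The key reduction. With `ρ = a / b`, the function `u = s g - q f` satisfies `b u = q a`, a
polynomial of degree less than `deg q + deg b`. Dividing by `b` preserves vanishing of coefficients
at both ends, so `u` is a polynomial of degree less than `deg q`. Then `q f = s g - u` has no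
negative coefficients, so neither has `f`, and `f` equals its Riesz projection `h`. -/
theorem mem_toeplitzGraph_iff {s q : ℂ[X]} (hq : q ≠ 0) (hroot : ∀ z, q.IsRoot z → ‖z‖ = 1)
    (g h : Hp p) :
    (g, h) ∈ toeplitzGraph p (algebraMap ℂ[X] (RatFunc ℂ) s / algebraMap ℂ[X] (RatFunc ℂ) q) ↔
      ∃ r ∈ polyLE ((q.natDegree : ℤ) - 1), s • g = q • h + polyHp p r := by
  constructor
  · rintro ⟨f, _, ⟨a, b, hb, hbr, hab, rfl⟩, e, P⟩
    simp only at e P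
    set u : LpT p := s • (g : LpT p) - q • f with hu
    have hbu : b • u = polyHp p (q * a) := by
      refine Lp.ext ?_
      have e' : (bd (algebraMap ℂ[X] (RatFunc ℂ) s / algebraMap ℂ[X] (RatFunc ℂ) q) * toL0 g : L0T)
          =ᵐ[haarT] ((f : L0T) + bd (algebraMap ℂ[X] (RatFunc ℂ) a /
            algebraMap ℂ[X] (RatFunc ℂ) b) : L0T) := by rw [← e]
      filter_upwards [e', coeFn_bd_div s q,
        AEEqFun.coeFn_mul (bd (algebraMap ℂ[X] (RatFunc ℂ) s / algebraMap ℂ[X] (RatFunc ℂ) q))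
          (toL0 g),
        AEEqFun.coeFn_add (f : L0T) (bd (algebraMap ℂ[X] (RatFunc ℂ) a /
          algebraMap ℂ[X] (RatFunc ℂ) b)), coeFn_bd_div a b, ae_eval_ne_zero hb,
        ae_eval_ne_zero hq, coeFn_polyHp (p := p) (q * a), coeFn_polySmul b u,
        Lp.coeFn_sub (s • (g : LpT p)) (q • f), coeFn_polySmul s (g : LpT p),
        coeFn_polySmul q f] with t h1 h2 h3 h4 h5 h6 h7 h8 h9 h10 h11 h12
      rw [h3, h4, Pi.mul_apply, Pi.add_apply, h2, h5] at h1
      rw [h8, h9, hu, h10, Pi.sub_apply, h11, h12, eval_mul]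
      change s.eval (t.toCircle : ℂ) / q.eval (t.toCircle : ℂ) * (g : LpT p) t = _ at h1
      field_simp at h1
      linear_combination h1
    have hcoef : ∀ n : ℤ, (n < 0 ∨ ((q.natDegree : ℤ) + b.natDegree) ≤ n) →
        fourierCoeff (fun t => b.eval (t.toCircle : ℂ) * (u : UnitAddCircle → ℂ) t) n = 0 := by
      intro n hn
      rw [← fourierCoeff_congr_ae (coeFn_polySmul b u), hbu, fourierCoeff_polyHp]
      split_ifs with h0
      · refine coeff_eq_zero_of_degree_lt ?_
        have h1 : (q * a).degree < (q * b).degree := by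
          rw [degree_mul, degree_mul]
          exact WithBot.add_lt_add_left (degree_ne_bot.2 hq) hab
        refine h1.trans_le ?_
        rw [degree_eq_natDegree (mul_ne_zero hq hb), natDegree_mul hq hb]
        exact_mod_cast by omega
      · rfl
    have hui := integrable_LpT u
    have hu1 := (coeff_zero_of_eval_mul _ b hb rfl hbr hui 0).1 fun m hm => hcoef m (Or.inl hm)
    obtain ⟨r, hr, hur⟩ := eq_polyHp_of_fourierCoeff (N := q.natDegree) hu1
      ((coeff_zero_of_eval_mul _ b hb rfl hbr hui q.natDegree).2 fun m hm => hcoef m (Or.inr hm))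
    have hqf : q • f = ((s • g - polyHp p r : Hp p) : LpT p) := by
      rw [Submodule.coe_sub, coe_polySmul, ← hur, hu, sub_sub_cancel]
    have hfH : f ∈ Hp p := by
      intro n hn
      refine (coeff_zero_of_eval_mul _ q hq rfl hroot (integrable_LpT f) 0).1 (fun m hm => ?_) n
        (by simpa using hn)
      rw [← fourierCoeff_congr_ae (coeFn_polySmul q f), hqf]
      exact (s • g - polyHp p r : Hp p).2 m (by simpa using hm)
    -- The difference `f - h` lies in both `H^p` and `K^p`.
    have hfh : f = (h : LpT p) := by
      rw [← sub_eq_zero]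
      refine Lp_eq_of_fourierCoeff fun n => ?_
      rw [fourierCoeff_Lp_zero]
      rcases lt_or_ge n 0 with hn | hn
      · exact (sub_mem hfH h.2) n (by simpa using hn)
      · exact P n (by simpa using hn)
    refine ⟨r, hr, Subtype.ext ?_⟩
    rw [Submodule.coe_add, coe_polySmul, coe_polySmul, ← hur, ← hfh, hu, add_sub_cancel]
  · rintro ⟨r, hr, e⟩
    refine ⟨h, _, ⟨r, q, hq, hroot, ?_, rfl⟩, ?_, ?_⟩
    · rw [degree_eq_natDegree hq]
      exact degree_lt_of_mem_polyLE hr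
    · have e' : (s • (g : LpT p) : LpT p) =ᵐ[haarT] (q • (h : LpT p) + polyHp p r : LpT p) := by
        rw [← coe_polySmul, ← coe_polySmul, ← Submodule.coe_add, e]
      refine AEEqFun.ext ?_
      filter_upwards [e', coeFn_bd_div s q,
        AEEqFun.coeFn_mul (bd (algebraMap ℂ[X] (RatFunc ℂ) s / algebraMap ℂ[X] (RatFunc ℂ) q))
          (toL0 g),
        AEEqFun.coeFn_add (toL0 h) (bd (algebraMap ℂ[X] (RatFunc ℂ) r /
          algebraMap ℂ[X] (RatFunc ℂ) q)), coeFn_bd_div r q,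
        ae_eval_ne_zero hq, coeFn_polyHp (p := p) r,
        Lp.coeFn_add (q • (h : LpT p)) (polyHp p r), coeFn_polySmul s (g : LpT p),
        coeFn_polySmul q (h : LpT p)] with t h1 h2 h3 h4 h5 h6 h7 h8 h9 h10
      rw [h8, Pi.add_apply, h9, h10, h7] at h1
      rw [h3, h4, Pi.mul_apply, Pi.add_apply, h2, h5]
      change _ * (g : LpT p) t = (h : LpT p) t + _
      field_simp
      linear_combination h1
    · simp [IsRieszProjection]

/-! ### Polynomials of bounded degree, and closedness of the graph -/

theorem polyLE_eq_degreeLT (n : ℤ) : polyLE n = degreeLT ℂ (n + 1).toNat := by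
  ext r
  rw [mem_degreeLT, degree_lt_iff_coeff_zero]
  exact ⟨fun h m hm => h m (by omega), fun h m hm => h m (by omega)⟩

theorem finrank_polyLE (n : ℤ) : Module.finrank ℂ (polyLE n) = (n + 1).toNat := by
  rw [polyLE_eq_degreeLT, (degreeLTEquiv ℂ _).finrank_eq, Module.finrank_fin_fun]

instance (n : ℤ) : FiniteDimensional ℂ (polyLE n) := by
  rw [polyLE_eq_degreeLT]
  exact Module.Finite.equiv (degreeLTEquiv ℂ _).symm

/-- Zero is listed separately because its `natDegree` is `0` while `n` may be negative. -/
theorem mem_polyLE_iff {n : ℤ} {r : ℂ[X]} : r ∈ polyLE n ↔ r = 0 ∨ (r.natDegree : ℤ) ≤ n := by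
  constructor
  · intro h
    by_contra! hr
    exact hr.1 (leadingCoeff_eq_zero.1 (h _ hr.2))
  · rintro (rfl | h)
    · exact zero_mem _
    · exact fun k hk => coeff_eq_zero_of_natDegree_lt (by omega)

/-- The graph of the Toeplitz operator is closed. -/
theorem isClosed_toeplitzGraph {s q : ℂ[X]} (hq : q ≠ 0) (hroot : ∀ z, q.IsRoot z → ‖z‖ = 1) :
    IsClosed (toeplitzGraph p
      (algebraMap ℂ[X] (RatFunc ℂ) s / algebraMap ℂ[X] (RatFunc ℂ) q) : Set (Hp p × Hp p)) := by
  -- The graph is the preimage of this finite dimensional space under the continuous map `(g, h) ↦ s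
  -- g - q h`.
  have hcl : IsClosed (((polyLE ((q.natDegree : ℤ) - 1)).map (polyHp p) : Submodule ℂ (Hp p)) :
      Set (Hp p)) := Submodule.closed_of_finiteDimensional _
  have hc : Continuous fun x : Hp p × Hp p => mulHp s x.1 - mulHp q x.2 := by fun_prop
  convert hcl.preimage hc
  ext ⟨g, h⟩
  rw [SetLike.mem_coe, mem_toeplitzGraph_iff hq hroot]
  simp only [mulHp_apply, Set.mem_preimage, SetLike.mem_coe, Submodule.mem_map]
  exact exists_congr fun r => and_congr_right fun _ => by rw [eq_sub_iff_add_eq', eq_comm]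

/-! ### Multiplication by `X - α` with `α` on the circle -/

theorem norm_X_pow_smul (N : ℕ) (f : LpT p) : ‖(X ^ N : ℂ[X]) • f‖ = ‖f‖ := by
  have h : ∀ᵐ t ∂haarT, ‖((X ^ N : ℂ[X]) • f : LpT p) t‖ = ‖f t‖ := by
    filter_upwards [coeFn_polySmul (X ^ N) f] with t h1
    rw [h1, norm_mul, eval_pow, eval_X, norm_pow, Circle.norm_coe, one_pow, one_mul]
  exact le_antisymm (Lp.norm_le_norm_of_ae_le (h.mono fun _ => le_of_eq))
    (Lp.norm_le_norm_of_ae_le (h.mono fun _ => ge_of_eq))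

/-- Since multiplication by `X ^ N` is isometric and commutes with `X - α`, this transfers a lower
bound from `H^p` to trigonometric polynomials. -/
theorem exists_X_pow_smul_mem_Hp {f : LpT p}
    (hf : f ∈ Submodule.span ℂ (Set.range (fourierLp (T := 1) p))) :
    ∃ N : ℕ, (X ^ N : ℂ[X]) • f ∈ Hp p := by
  induction hf using Submodule.span_induction with
  | mem f hf =>
    obtain ⟨m, rfl⟩ := hf
    refine ⟨m.natAbs, ?_⟩
    convert (polyHp p (X ^ (m + m.natAbs).toNat)).2
    refine Lp.ext ?_
    filter_upwards [coeFn_polySmul (X ^ m.natAbs) (fourierLp (T := 1) p m),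
      coeFn_fourierLp (T := 1) p m, coeFn_polyHp (p := p) (X ^ (m + m.natAbs).toNat)]
      with t h1 h2 h3
    have hX : ∀ k : ℕ, ((t.toCircle : ℂ)) ^ k = fourier (T := 1) k t := fun k => by
      simp [AddCircle.toCircle_nsmul]
    rw [h1, h2, h3, eval_pow, eval_pow, eval_X, hX, hX, ← fourier_add,
      Int.toNat_of_nonneg (by omega), add_comm]
  | zero => exact ⟨0, by rw [smul_zero]; exact zero_mem _⟩
  | add f g _ _ hf hg =>
    obtain ⟨M, hM⟩ := hf
    obtain ⟨N, hN⟩ := hg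
    refine ⟨M + N, ?_⟩
    rw [smul_add]
    refine add_mem ?_ ?_
    · rw [add_comm, pow_add, mul_smul]
      exact ((X ^ N : ℂ[X]) • (⟨_, hM⟩ : Hp p)).2
    · rw [pow_add, mul_smul]
      exact ((X ^ M : ℂ[X]) • (⟨_, hN⟩ : Hp p)).2
  | smul c f _ hf =>
    obtain ⟨N, hN⟩ := hf
    refine ⟨N, ?_⟩
    rw [← mulC_evalC, map_smul]
    exact Submodule.smul_mem _ c hN

theorem exists_toCircle_eq {α : ℂ} (hα : ‖α‖ = 1) : ∃ t : UnitAddCircle, (t.toCircle : ℂ) = α := by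
  obtain ⟨t, ht⟩ := (AddCircle.homeomorphCircle (T := 1) one_ne_zero).surjective
    ⟨α, mem_sphere_zero_iff_norm.2 hα⟩
  refine ⟨t, ?_⟩
  rw [← AddCircle.homeomorphCircle_apply one_ne_zero, ht]

/-- Take the indicator of the open arc where `|z - α| < ε`, which has positive measure. -/
theorem exists_norm_X_sub_C_smul_le {α : ℂ} (hα : ‖α‖ = 1) (hp' : p ≠ ∞) {ε : ℝ} (hε : 0 < ε) :
    ∃ f : LpT p, f ≠ 0 ∧ ‖(X - C α) • f‖ ≤ ε * ‖f‖ := by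
  obtain ⟨t₀, ht₀⟩ := exists_toCircle_eq hα
  let B : Set UnitAddCircle := {t | ‖(t.toCircle : ℂ) - α‖ < ε}
  have hB : IsOpen B := isOpen_lt
    ((continuous_subtype_val.comp AddCircle.continuous_toCircle).sub continuous_const).norm
    continuous_const
  have hpos : 0 < haarT B := hB.measure_pos haarT ⟨t₀, by simp [B, ht₀, hε]⟩
  have hp0 : p ≠ 0 := (zero_lt_one.trans_le (Fact.out : 1 ≤ p)).ne'
  refine ⟨indicatorConstLp p hB.measurableSet (measure_ne_top _ _) (1 : ℂ), ?_, ?_⟩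
  · rw [← norm_ne_zero_iff, norm_indicatorConstLp hp0 hp']
    have : 0 < haarT.real B := ENNReal.toReal_pos hpos.ne' (measure_ne_top _ _)
    exact (mul_pos (by simp) (Real.rpow_pos_of_pos this _)).ne'
  · refine Lp.norm_le_mul_norm_of_ae_le_mul ?_
    filter_upwards [coeFn_polySmul (X - C α)
      (indicatorConstLp p hB.measurableSet (measure_ne_top haarT B) (1 : ℂ)),
      indicatorConstLp_coeFn (p := p) (hs := hB.measurableSet) (hμs := measure_ne_top haarT B)
        (c := (1 : ℂ))] with t h1 h2
    rw [h1, h2, norm_mul]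
    by_cases ht : t ∈ B
    · refine mul_le_mul_of_nonneg_right ?_ (norm_nonneg _)
      simpa using ht.le
    · simp [ht]

/-- If `α` lies on the circle, then `(X - α) H^p` has infinite codimension in `H^p`. -/
theorem not_finiteDimensional_quotient_X_sub_C {α : ℂ} (hα : ‖α‖ = 1) (hp' : p ≠ ∞) :
    ¬ FiniteDimensional ℂ (Hp p ⧸ (mulHp (p := p) (X - C α)).range) := by
  intro hfin
  set M := mulHp (p := p) (X - C α)
  have hinj : Function.Injective M := fun f g h => polySmul_cancel (X_sub_C_ne_zero α) h
  obtain ⟨G, hG⟩ := exists_isCompl M.range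
  have : FiniteDimensional ℂ G := Module.Finite.equiv (Submodule.quotientEquivOfIsCompl _ G hG)
  -- An injective bounded operator whose range has a closed complement has closed range, and is
  -- therefore bounded below.
  have hcl := M.closed_complemented_range_of_isCompl_of_ker_eq_bot G hG
    (Submodule.closed_of_finiteDimensional G) (LinearMap.ker_eq_bot.2 hinj)
  obtain ⟨K, hK⟩ := M.antilipschitz_of_injective_of_isClosed_range hinj hcl
  have hH : ∀ h : Hp p, ‖(h : LpT p)‖ ≤ K * ‖(X - C α) • (h : LpT p)‖ := fun h => by
    have := hK.le_mul_norm_sub h 0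
    rwa [map_zero, add_zero, add_zero, norm_neg, norm_neg] at this
  have hL : ∀ f : LpT p, ‖f‖ ≤ K * ‖mulC (evalC (X - C α)) f‖ := by
    have hd := span_fourierLp_closure_eq_top (T := 1) (p := p) hp'
    intro f
    have hf : f ∈ closure
        ((Submodule.span ℂ (Set.range (fourierLp (T := 1) p)) : Submodule ℂ (LpT p)) :
          Set (LpT p)) := by
      rw [← Submodule.topologicalClosure_coe, hd]; trivial
    refine closure_minimal (fun g hg => ?_) ?_ hf (s := _)
      (t := {f : LpT p | ‖f‖ ≤ K * ‖mulC (evalC (X - C α)) f‖})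
    · obtain ⟨N, hN⟩ := exists_X_pow_smul_mem_Hp hg
      have := hH ⟨_, hN⟩
      rwa [smul_comm, norm_X_pow_smul, norm_X_pow_smul] at this
    · exact isClosed_le (by fun_prop) (by fun_prop)
  -- This `ε` satisfies `K ε < 1`, contradicting the lower bound.
  obtain ⟨f, hf0, hf⟩ := exists_norm_X_sub_C_smul_le (p := p) hα hp' (ε := 1 / (K + 1))
    (by positivity)
  have h1 := hL f
  rw [mulC_evalC] at h1
  have h2 : 0 < ‖f‖ := norm_pos_iff.2 hf0
  have h3 : ‖f‖ ≤ K * (1 / (K + 1) * ‖f‖) :=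
    h1.trans (mul_le_mul_of_nonneg_left hf K.coe_nonneg)
  have h4 : (0 : ℝ) < K + 1 := by positivity
  field_simp at h3
  linarith

end RationalToeplitz

/-! ### Kernel and range of an unbounded operator in terms of its graph -/

namespace LinearPMap

variable {E F : Type*} [NormedAddCommGroup E] [NormedSpace ℂ E] [NormedAddCommGroup F]
  [NormedSpace ℂ F]

theorem mem_kernel_iff {T : E →ₗ.[ℂ] F} {x : E} : x ∈ T.kernel ↔ (x, 0) ∈ T.graph := by
  rw [kernel, Submodule.mem_map, mem_graph_iff]
  constructor
  · rintro ⟨y, hy, rfl⟩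
    exact ⟨y, rfl, hy⟩
  · rintro ⟨y, rfl, hy⟩
    exact ⟨y, hy, rfl⟩

theorem mem_ran_iff {T : E →ₗ.[ℂ] F} {y : F} : y ∈ T.ran ↔ ∃ x, (x, y) ∈ T.graph :=
  T.mem_range_iff

theorem injective_toFun_iff {T : E →ₗ.[ℂ] F} : Function.Injective T.toFun ↔ T.kernel = ⊥ := by
  rw [kernel, ← LinearMap.ker_eq_bot]
  exact ((Submodule.map_injective_of_injective T.domain.injective_subtype).eq_iff'
    (Submodule.map_bot _)).symm

theorem surjective_toFun_iff {T : E →ₗ.[ℂ] F} : Function.Surjective T.toFun ↔ T.ran = ⊤ :=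
  LinearMap.range_eq_top.symm

end LinearPMap

namespace RationalToeplitz

variable {p : ℝ≥0∞} [Fact (1 ≤ p)]

/-! ### Domain, range and kernel -/

/-- The fraction `s / q` as a rational function. -/
abbrev frac (s q : ℂ[X]) : RatFunc ℂ :=
  algebraMap ℂ[X] (RatFunc ℂ) s / algebraMap ℂ[X] (RatFunc ℂ) q

theorem mod_mem_polyLE (a : ℂ[X]) {q : ℂ[X]} (hq : q ≠ 0) :
    a % q ∈ polyLE ((q.natDegree : ℤ) - 1) :=
  mem_polyLE_of_degree_lt ((degree_eq_natDegree hq).symm ▸ degree_mod_lt a hq)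

section

variable {s q : ℂ[X]} (hq : q ≠ 0) (hroot : ∀ z, q.IsRoot z → ‖z‖ = 1)
include hq hroot

theorem mem_graph_toeplitz_iff {g h : Hp p} : (g, h) ∈ (toeplitz p (frac s q)).graph ↔
    ∃ r ∈ polyLE ((q.natDegree : ℤ) - 1), s • g = q • h + polyHp p r := by
  rw [toeplitz_graph, mem_toeplitzGraph_iff hq hroot]

theorem isClosed_toeplitz : (toeplitz p (frac s q)).IsClosed := by
  rw [LinearPMap.IsClosed, toeplitz_graph]
  exact isClosed_toeplitzGraph hq hroot

/-- With `a s + b q = 1`, the relation `s g = q h + r` gives `g = q (a h + b g) + a r`; reduce `a r`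
modulo `q`. Conversely `s (q h + r) = q (s h) + s r`; reduce `s r` modulo `q`. -/
theorem mem_domain_toeplitz_iff (hsq : IsCoprime s q) {g : Hp p} :
    g ∈ (toeplitz p (frac s q)).domain ↔
      ∃ h : Hp p, ∃ r ∈ polyLE ((q.natDegree : ℤ) - 1), g = q • h + polyHp p r := by
  rw [LinearPMap.mem_domain_iff]
  simp only [mem_graph_toeplitz_iff hq hroot]
  constructor
  · rintro ⟨h, r, -, e⟩
    obtain ⟨a, b, hab⟩ := hsq
    refine ⟨a • h + b • g + polyHp p (a * r / q), a * r % q, mod_mem_polyLE _ hq, ?_⟩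
    have h1 := congrArg (polyHp p) (EuclideanDomain.div_add_mod (a * r) q)
    rw [map_add, ← smul_polyHp, ← smul_polyHp] at h1
    linear_combination (norm := module) hab • (-g) + a • e - h1
  · rintro ⟨h, r, -, rfl⟩
    refine ⟨s • h + polyHp p (s * r / q), s * r % q, mod_mem_polyLE _ hq, ?_⟩
    have h1 := congrArg (polyHp p) (EuclideanDomain.div_add_mod (s * r) q)
    rw [map_add, ← smul_polyHp, ← smul_polyHp] at h1
    linear_combination (norm := module) - h1

/-- Writing `g = q k + r₁` in `s g = q h + r` gives `q (h - s k) = s r₁ - r`. The roots of `q` lie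
on the circle, so `h - s k` is a polynomial, and this equation is the defining condition of
`tildeP`. -/
theorem mem_ran_toeplitz_iff (hsq : IsCoprime s q) {h : Hp p} :
    h ∈ (toeplitz p (frac s q)).ran ↔
      ∃ k : Hp p, ∃ r ∈ tildeP s q, h = s • k + polyHp p r := by
  rw [LinearPMap.mem_ran_iff]
  constructor
  · rintro ⟨g, hg⟩
    obtain ⟨k, r₁, hr₁, rfl⟩ := (mem_domain_toeplitz_iff hq hroot hsq).1
      (LinearPMap.mem_domain_of_mem_graph hg)
    obtain ⟨r, hr, e⟩ := (mem_graph_toeplitz_iff hq hroot).1 hg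
    have h1 : q • (h - s • k) = polyHp p (s * r₁ - r) := by
      rw [map_sub, ← smul_polyHp]
      linear_combination (norm := module) -e
    obtain ⟨c, hc, hcq⟩ := exists_polyHp_of_smul_eq _ q hq rfl (fun z hz => (hroot z hz).le) _ _ h1
    exact ⟨k, c, ⟨r₁, hr₁, -r, neg_mem hr, by linear_combination -hcq⟩,
      by rw [← hc, add_sub_cancel]⟩
  · rintro ⟨k, r, ⟨r₁, hr₁, r₂, hr₂, e⟩, rfl⟩
    refine ⟨q • k + polyHp p r₁, (mem_graph_toeplitz_iff hq hroot).2 ⟨-r₂, neg_mem hr₂, ?_⟩⟩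
    have h1 := congrArg (polyHp p) e
    rw [mul_comm r, mul_comm r₁, map_add, ← smul_polyHp, ← smul_polyHp] at h1
    rw [map_neg]
    linear_combination (norm := module) -h1

omit hroot in
theorem tildeP_le : tildeP s q ≤ polyLE ((s.natDegree : ℤ) - 1) := by
  rintro r ⟨r₁, hr₁, r₂, hr₂, e⟩
  rcases eq_or_ne r 0 with rfl | hr
  · exact zero_mem _
  have h0 : r.natDegree + q.natDegree = (r₁ * s + r₂).natDegree := by
    rw [← e, natDegree_mul hr hq]
  rw [mem_polyLE_iff] at hr₁ hr₂ ⊢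
  rcases hr₂ with rfl | hr₂
  · rcases hr₁ with rfl | hr₁
    · simp [hr, hq] at e
    · have := natDegree_mul_le (p := r₁) (q := s)
      rw [add_zero] at h0
      right; omega
  · rcases hr₁ with rfl | hr₁
    · rw [zero_mul, zero_add] at h0
      omega
    · have h1 := natDegree_mul_le (p := r₁) (q := s)
      have h2 := natDegree_add_le (r₁ * s) r₂
      right; omega

end

/-! ### Kernel, complement of the range and index for `s = s₁ s₂` -/

section

variable {s₁ s₂ q : ℂ[X]} (hq : q ≠ 0) (hroot : ∀ z, q.IsRoot z → ‖z‖ = 1)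
  (h₁ : s₁ ≠ 0) (hr₁ : ∀ z, s₁.IsRoot z → ‖z‖ < 1)
include hq hroot h₁ hr₁

/-- If `s₁ s₂ g` is a polynomial of degree less than `deg q`, division by `s₁` leaves a polynomial
`s₂ g` whose degree is lower by `deg s₁`. -/
theorem mem_kernel_toeplitz_iff {g : Hp p} :
    g ∈ (toeplitz p (frac (s₁ * s₂) q)).kernel ↔
      ∃ r ∈ polyLE ((q.natDegree : ℤ) - s₁.natDegree - 1), s₂ • g = polyHp p r := by
  rw [LinearPMap.mem_kernel_iff, mem_graph_toeplitz_iff hq hroot]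
  simp only [smul_zero, zero_add]
  constructor
  · rintro ⟨r, hr, e⟩
    rw [mul_smul] at e
    obtain ⟨c, hc, rfl⟩ := exists_polyHp_of_smul_eq _ s₁ h₁ rfl (fun z hz => (hr₁ z hz).le) _ _ e
    refine ⟨c, ?_, hc⟩
    rw [mem_polyLE_iff] at hr ⊢
    rcases eq_or_ne c 0 with rfl | hc0
    · exact Or.inl rfl
    · rw [natDegree_mul h₁ hc0] at hr
      have := hr.resolve_left (mul_ne_zero h₁ hc0)
      right; push_cast at this; omega
  · rintro ⟨r, hr, e⟩
    refine ⟨s₁ * r, ?_, by rw [mul_smul, e, smul_polyHp]⟩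
    rw [mem_polyLE_iff] at hr ⊢
    rcases eq_or_ne r 0 with rfl | hr0
    · simp
    · rw [natDegree_mul h₁ hr0]
      have := hr.resolve_left hr0
      right; push_cast; omega

variable (h₂ : s₂ ≠ 0) (hr₂ : ∀ z, s₂.IsRoot z → 1 < ‖z‖)
include h₂ hr₂

/-- Disjointness: if `s g = q c + r`, then `s₁` divides `q c + r`, which for `c ≠ 0` has degree `deg
q + deg c < deg s₁`. Spanning: divide `q h` by `s₁` with remainder `d`, and divide the quotient by
`s₂`, so `q h = s k + d`; then `q (h - d / q) = s k + d % q` puts `h - d / q` in the range. -/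
theorem isCompl_ran_toeplitz :
    IsCompl (toeplitz p (frac (s₁ * s₂) q)).ran
      ((polyLE ((s₁.natDegree : ℤ) - q.natDegree - 1)).map (polyHp p)) := by
  constructor
  · rw [Submodule.disjoint_def]
    rintro _ hx ⟨c, hc, rfl⟩
    obtain ⟨g, hg⟩ := LinearPMap.mem_ran_iff.1 hx
    obtain ⟨r, hr, e⟩ := (mem_graph_toeplitz_iff hq hroot).1 hg
    rw [mul_smul, smul_polyHp, ← map_add] at e
    obtain ⟨b, -, hb⟩ := exists_polyHp_of_smul_eq _ s₁ h₁ rfl (fun z hz => (hr₁ z hz).le) _ _ e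
    by_contra hne
    have hc0 : c ≠ 0 := by rintro rfl; exact hne (map_zero _)
    have hcn := (mem_polyLE_iff.1 hc).resolve_left hc0
    have hqc : (q * c).natDegree = q.natDegree + c.natDegree := natDegree_mul hq hc0
    have hrc : r.degree < (q * c).degree := by
      refine (degree_lt_of_mem_polyLE hr).trans_le ?_
      rw [degree_eq_natDegree (mul_ne_zero hq hc0), hqc]
      exact_mod_cast by omega
    have hd : (q * c + r).natDegree = (q * c).natDegree :=
      natDegree_eq_of_degree_eq (degree_add_eq_left_of_degree_lt hrc)
    rw [hb, hqc] at hd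
    rcases eq_or_ne b 0 with rfl | hb0
    · have := degree_add_eq_left_of_degree_lt hrc
      rw [hb, mul_zero, degree_zero] at this
      exact degree_ne_bot.2 (mul_ne_zero hq hc0) this.symm
    · rw [natDegree_mul h₁ hb0] at hd
      omega
  · rw [codisjoint_iff, eq_top_iff]
    rintro h -
    obtain ⟨k', d, hd, e⟩ := exists_smul_add_polyHp_of_roots_inside _ s₁ h₁ rfl hr₁ (q • h)
    obtain ⟨k, rfl⟩ := exists_smul_eq_of_roots_outside _ s₂ h₂ rfl hr₂ k'
    refine Submodule.mem_sup.2 ⟨h - polyHp p (d / q), ?_, polyHp p (d / q),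
      Submodule.mem_map_of_mem ?_, sub_add_cancel _ _⟩
    · refine LinearPMap.mem_ran_iff.2 ⟨k, (mem_graph_toeplitz_iff hq hroot).2
        ⟨-(d % q), neg_mem (mod_mem_polyLE _ hq), ?_⟩⟩
      have h1 := congrArg (polyHp p) (EuclideanDomain.div_add_mod d q)
      rw [map_add, ← smul_polyHp] at h1
      rw [map_neg]
      linear_combination (norm := module) h1 - e
    · rw [mem_polyLE_iff]
      by_cases hdq : d.degree < q.degree
      · exact Or.inl ((Polynomial.div_eq_zero_iff hq).2 hdq)
      · have h1 := degree_add_div hq (not_lt.1 hdq)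
        have hd0 : d ≠ 0 := by
          rintro rfl
          exact hdq (by simpa [bot_lt_iff_ne_bot] using hq)
        have hc0 : d / q ≠ 0 := fun h0 => hdq ((Polynomial.div_eq_zero_iff hq).1 h0)
        rw [degree_eq_natDegree hq, degree_eq_natDegree hc0, degree_eq_natDegree hd0] at h1
        rw [degree_eq_natDegree hd0, degree_eq_natDegree h₁] at hd
        have h2 : q.natDegree + (d / q).natDegree = d.natDegree := by exact_mod_cast h1
        have h3 : d.natDegree < s₁.natDegree := by exact_mod_cast hd
        right; omega

/-- The kernel is isomorphic to a space of polynomials. -/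
def kernelToeplitzEquiv : (toeplitz p (frac (s₁ * s₂) q)).kernel ≃ₗ[ℂ]
    polyLE ((q.natDegree : ℤ) - s₁.natDegree - 1) :=
  have hinj : Function.Injective (mulHp (p := p) s₂).toLinearMap := fun _ _ h => polySmul_cancel h₂ h
  -- Multiplication by `s₂` reaches every such polynomial because `s₂` is invertible on `H^p`.
  have heq : (toeplitz p (frac (s₁ * s₂) q)).kernel.map (mulHp s₂).toLinearMap =
      (polyLE ((q.natDegree : ℤ) - s₁.natDegree - 1)).map (polyHp p) := by
    ext h
    simp only [Submodule.mem_map, mem_kernel_toeplitz_iff hq hroot h₁ hr₁]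
    constructor
    · rintro ⟨g, ⟨r, hr, e⟩, rfl⟩
      exact ⟨r, hr, e.symm⟩
    · rintro ⟨r, hr, rfl⟩
      obtain ⟨g, hg⟩ := exists_smul_eq_of_roots_outside _ s₂ h₂ rfl hr₂ (polyHp p r)
      exact ⟨g, ⟨r, hr, hg⟩, hg⟩
  (Submodule.equivMapOfInjective _ hinj _).trans <| (LinearEquiv.ofEq _ _ heq).trans
    (Submodule.equivMapOfInjective _ polyHp_injective _).symm

theorem finiteDimensional_kernel_toeplitz :
    FiniteDimensional ℂ (toeplitz p (frac (s₁ * s₂) q)).kernel :=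
  Module.Finite.equiv (kernelToeplitzEquiv hq hroot h₁ hr₁ h₂ hr₂).symm

/-- The truncated subtraction is intended: the dimension is zero when `deg q ≤ deg s₁`. The
codimension of the range is the opposite truncated difference, so one of the two always vanishes. -/
theorem finrank_kernel_toeplitz :
    Module.finrank ℂ (toeplitz p (frac (s₁ * s₂) q)).kernel = q.natDegree - s₁.natDegree := by
  rw [(kernelToeplitzEquiv hq hroot h₁ hr₁ h₂ hr₂).finrank_eq, finrank_polyLE]
  omega

omit hq hroot h₁ hr₁ h₂ hr₂ in
theorem finrank_map_polyHp :
    Module.finrank ℂ ((polyLE ((s₁.natDegree : ℤ) - q.natDegree - 1)).map (polyHp p)) =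
      s₁.natDegree - q.natDegree := by
  rw [← (Submodule.equivMapOfInjective _ polyHp_injective _).finrank_eq, finrank_polyLE]
  omega

theorem finrank_quotient_ran_toeplitz :
    Module.finrank ℂ (Hp p ⧸ (toeplitz p (frac (s₁ * s₂) q)).ran) =
      s₁.natDegree - q.natDegree := by
  rw [(Submodule.quotientEquivOfIsCompl _ _
    (isCompl_ran_toeplitz hq hroot h₁ hr₁ h₂ hr₂)).finrank_eq, finrank_map_polyHp]

theorem isFredholm_toeplitz : (toeplitz p (frac (s₁ * s₂) q)).IsFredholm where
  isClosed := isClosed_toeplitz hq hroot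
  finite_kernel := finiteDimensional_kernel_toeplitz hq hroot h₁ hr₁ h₂ hr₂
  finite_complement := ⟨_, isCompl_ran_toeplitz hq hroot h₁ hr₁ h₂ hr₂, inferInstance⟩

theorem injective_toeplitz_iff :
    Function.Injective (toeplitz p (frac (s₁ * s₂) q)).toFun ↔ q.natDegree ≤ s₁.natDegree := by
  have := finiteDimensional_kernel_toeplitz (p := p) hq hroot h₁ hr₁ h₂ hr₂
  rw [LinearPMap.injective_toFun_iff, ← Submodule.finrank_eq_zero,
    finrank_kernel_toeplitz hq hroot h₁ hr₁ h₂ hr₂, Nat.sub_eq_zero_iff_le]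

theorem surjective_toeplitz_iff :
    Function.Surjective (toeplitz p (frac (s₁ * s₂) q)).toFun ↔ s₁.natDegree ≤ q.natDegree := by
  have hc := isCompl_ran_toeplitz (p := p) hq hroot h₁ hr₁ h₂ hr₂
  rw [LinearPMap.surjective_toFun_iff, ← Nat.sub_eq_zero_iff_le, ← finrank_map_polyHp (p := p),
    Submodule.finrank_eq_zero]
  exact ⟨fun h => eq_bot_of_top_isCompl (h ▸ hc), fun h => eq_top_of_isCompl_bot (h ▸ hc)⟩

end

/-! ### Zeroes on the circle -/

/-- Modulo `(X - α) H^p` every polynomial is a constant, so the range lies in `(X - α) H^p + ℂ` and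
would force `(X - α) H^p` to have finite codimension. The case `s = 0` is included. -/
theorem not_isRoot_of_isFredholm_toeplitz {s q : ℂ[X]} (hq : q ≠ 0)
    (hroot : ∀ z, q.IsRoot z → ‖z‖ = 1) (hsq : IsCoprime s q) (hp' : p ≠ ∞)
    (hT : (toeplitz p (frac s q)).IsFredholm) {α : ℂ} (hα : ‖α‖ = 1) : ¬ s.IsRoot α := by
  intro hs
  obtain ⟨s', rfl⟩ := dvd_iff_isRoot.2 hs
  obtain ⟨D, hD, hfin⟩ := hT.finite_complement
  refine not_finiteDimensional_quotient_X_sub_C (p := p) hα hp' ?_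
  set R := (mulHp (p := p) (X - C α)).range
  let A : Submodule ℂ (Hp p) := ℂ ∙ polyHp p 1
  have hR : ∀ x : Hp p, (X - C α) • x ∈ R := fun x => ⟨x, mulHp_apply _ x⟩
  have hle : (toeplitz p (frac ((X - C α) * s') q)).ran ≤ R ⊔ A := by
    intro h hh
    obtain ⟨k, r, -, rfl⟩ := (mem_ran_toeplitz_iff hq hroot hsq).1 hh
    have hr := modByMonic_add_div r (X - C α)
    rw [modByMonic_X_sub_C_eq_C_eval] at hr
    refine Submodule.mem_sup.2 ⟨(X - C α) • (s' • k + polyHp p (r /ₘ (X - C α))), hR _,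
      r.eval α • polyHp p 1, Submodule.smul_mem _ _ (Submodule.mem_span_singleton_self _), ?_⟩
    have h1 := congrArg (polyHp p) hr
    rw [map_add, ← smul_polyHp] at h1
    have h2 : polyHp p (C (r.eval α)) = r.eval α • polyHp p 1 := by
      rw [← map_smul, smul_eq_C_mul, mul_one]
    rw [← h2]
    linear_combination (norm := module) h1
  -- Hence the finite dimensional space `A ⊔ D` maps onto the quotient by `R`.
  have htop : R ⊔ (A ⊔ D) = ⊤ := by
    rw [eq_top_iff, ← hD.sup_eq_top, ← sup_assoc]
    exact sup_le_sup_right hle D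
  refine Module.Finite.of_surjective (R.mkQ.comp (A ⊔ D).subtype) ?_
  rw [← LinearMap.range_eq_top, LinearMap.range_comp, Submodule.range_subtype,
    Submodule.map_mkQ_eq_top, htop]

/-! ### Factorization of polynomials without roots on the circle -/

/-- Split the roots by modulus; the leading coefficient goes to `s₂`. -/
theorem exists_factorization_of_not_isRoot {s : ℂ[X]} (hs0 : s ≠ 0)
    (hs : ∀ z : ℂ, ‖z‖ = 1 → ¬ s.IsRoot z) :
    ∃ s₁ s₂ : ℂ[X], s = s₁ * s₂ ∧ (∀ z : ℂ, s₁.IsRoot z → ‖z‖ < 1) ∧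
      (∀ z : ℂ, s₂.IsRoot z → 1 < ‖z‖) := by
  have hroots : ∀ m : Multiset ℂ, ∀ z, (m.map fun a => X - C a).prod.IsRoot z → z ∈ m := by
    intro m z hz
    rw [← mem_roots ((monic_multisetProd_X_sub_C m).ne_zero), roots_multiset_prod_X_sub_C] at hz
    exact hz
  refine ⟨((s.roots.filter fun z => ‖z‖ < 1).map fun a => X - C a).prod,
    C s.leadingCoeff * ((s.roots.filter fun z => ¬ ‖z‖ < 1).map fun a => X - C a).prod,
    ?_, fun z hz => (Multiset.mem_filter.1 (hroots _ z hz)).2, fun z hz => ?_⟩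
  · rw [mul_left_comm, ← Multiset.prod_add, ← Multiset.map_add, Multiset.filter_add_not]
    exact (IsAlgClosed.splits s).eq_prod_roots
  · rcases root_mul.1 hz with h | h
    · simp [hs0] at h
    · obtain ⟨h1, h2⟩ := Multiset.mem_filter.1 (hroots _ z h)
      exact lt_of_le_of_ne (not_lt.1 h2) fun h3 => hs z h3.symm ((mem_roots hs0).1 h1)

theorem card_filter_roots_mul {s₁ s₂ : ℂ[X]} (hs : s₁ * s₂ ≠ 0)
    (h₁ : ∀ z : ℂ, s₁.IsRoot z → ‖z‖ < 1) (h₂ : ∀ z : ℂ, s₂.IsRoot z → 1 < ‖z‖) :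
    ((s₁ * s₂).roots.filter fun z => ‖z‖ < 1).card = s₁.natDegree := by
  rw [roots_mul hs, Multiset.filter_add,
    Multiset.filter_eq_self.2 fun z hz => h₁ z (isRoot_of_mem_roots hz),
    Multiset.filter_eq_nil.2 fun z hz => (h₂ z (isRoot_of_mem_roots hz)).not_gt, add_zero]
  exact (IsAlgClosed.splits s₁).natDegree_eq_card_roots.symm

/-! ### From identities in `H^p` to classes of functions on the circle -/

/-- `s g = r` means that `g` is the rational function `r / s`. -/
theorem smul_eq_polyHp_iff {s r : ℂ[X]} (hs : s ≠ 0) {g : Hp p} :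
    s • g = polyHp p r ↔
      toL0 g = bd (algebraMap ℂ[X] (RatFunc ℂ) r / algebraMap ℂ[X] (RatFunc ℂ) s) := by
  constructor
  · intro h
    refine AEEqFun.ext ?_
    have h' : (s • (g : LpT p) : LpT p) =ᵐ[haarT] (polyHp p r : LpT p) := by
      rw [← coe_polySmul, h]
    filter_upwards [h', coeFn_polySmul s (g : LpT p), coeFn_polyHp (p := p) r, coeFn_bd_div r s,
      ae_eval_ne_zero hs] with t h1 h2 h3 h4 h5
    rw [h2, h3] at h1
    rw [h4, eq_div_iff h5, mul_comm]
    exact h1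
  · intro h
    refine Subtype.ext (Lp.ext ?_)
    have h' : (toL0 g : UnitAddCircle → ℂ) =ᵐ[haarT]
      (bd (algebraMap ℂ[X] (RatFunc ℂ) r / algebraMap ℂ[X] (RatFunc ℂ) s) : L0T) := by rw [h]
    filter_upwards [h', coeFn_polySmul s (g : LpT p), coeFn_polyHp (p := p) r, coeFn_bd_div r s,
      ae_eval_ne_zero hs] with t h1 h2 h3 h4 h5
    rw [h4, eq_div_iff h5, mul_comm] at h1
    rw [coe_polySmul, h2, h3]
    exact h1

/-- Serves both the domain and the range, which have the same shape. -/
theorem toL0_image_eq {V : Submodule ℂ (Hp p)} {s : ℂ[X]} {W : Submodule ℂ ℂ[X]}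
    (h : ∀ g, g ∈ V ↔ ∃ k : Hp p, ∃ r ∈ W, g = s • k + polyHp p r) :
    toL0 '' (V : Set (Hp p)) =
      {G : L0T | ∃ k : Hp p, ∃ r ∈ W, G = bdPoly s * toL0 k + bdPoly r} := by
  ext G
  constructor
  · rintro ⟨g, hg, rfl⟩
    obtain ⟨k, r, hr, rfl⟩ := (h g).1 hg
    exact ⟨k, r, hr, by rw [toL0_add, toL0_smul, toL0_polyHp]⟩
  · rintro ⟨k, r, hr, rfl⟩
    exact ⟨s • k + polyHp p r, (h _).2 ⟨k, r, hr, rfl⟩, by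
      rw [toL0_add, toL0_smul, toL0_polyHp]⟩

end RationalToeplitz
end

/-! ### The main theorem -/

theorem theorem1p2 (p : ℝ≥0∞) [Fact (1 ≤ p)] (hp : 1 < p) (hp' : p ≠ ∞)
    (ω : RatFunc ℂ) (hω : ω ∈ ratT)
    (s q : ℂ[X]) (hq : q ≠ 0) (hsq : IsCoprime s q)
    (hωsq : ω = algebraMap ℂ[X] (RatFunc ℂ) s / algebraMap ℂ[X] (RatFunc ℂ) q) :
    -- Fredholm if and only if there are no zeroes on the circle
    ((toeplitz p ω).IsFredholm ↔ ∀ z : ℂ, ‖z‖ = 1 → ¬ ω.num.IsRoot z) ∧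
    ((∀ z : ℂ, ‖z‖ = 1 → ¬ s.IsRoot z) →
      -- the domain
      toL0 '' ((toeplitz p ω).domain : Set (Hp p)) =
        {G : L0T | ∃ h : Hp p, ∃ r ∈ polyLE (q.natDegree - 1), G = bdPoly q * toL0 h + bdPoly r} ∧
      -- the range
      toL0 '' ((toeplitz p ω).ran : Set (Hp p)) =
        {G : L0T | ∃ h : Hp p, ∃ r ∈ tildeP s q, G = bdPoly s * toL0 h + bdPoly r} ∧
      tildeP s q ≤ polyLE (s.natDegree - 1) ∧
      -- injectivity or surjectivity
      (Function.Injective (toeplitz p ω).toFun ∨ Function.Surjective (toeplitz p ω).toFun) ∧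
      -- the index
      (toeplitz p ω).fredholmIndex =
        ((poles ω).card : ℤ) - ((zeroes ω).filter fun z => ‖z‖ < 1).card ∧
      ∀ s₁ s₂ : ℂ[X], s = s₁ * s₂ →
        (∀ z : ℂ, s₁.IsRoot z → ‖z‖ < 1) → (∀ z : ℂ, s₂.IsRoot z → 1 < ‖z‖) →
        -- the kernel
        toL0 '' ((toeplitz p ω).kernel : Set (Hp p)) =
          {G : L0T | ∃ r₀ ∈ polyLE ((q.natDegree : ℤ) - s₁.natDegree - 1),
            G = bd (algebraMap ℂ[X] (RatFunc ℂ) r₀ / algebraMap ℂ[X] (RatFunc ℂ) s₂)} ∧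
        -- a complement of the range
        IsCompl (toeplitz p ω).ran
          ((polyLE ((s₁.natDegree : ℤ) - q.natDegree - 1)).map (polyHp p)) ∧
        -- bijectivity
        ((Function.Injective (toeplitz p ω).toFun ∧ Function.Surjective (toeplitz p ω).toFun) ↔
          s₁.natDegree = q.natDegree)) := by
  have hroot : ∀ z, q.IsRoot z → ‖z‖ = 1 := fun z hz => norm_root_of_mem_ratT hq hsq hωsq hω hz
  have hnum := associated_num hq hsq hωsq
  have hden := associated_denom hq hsq hωsq
  have hne : (∀ z : ℂ, ‖z‖ = 1 → ¬ s.IsRoot z) → s ≠ 0 := by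
    rintro h rfl
    exact h 1 (by simp) (by simp)
  have hpoles : (poles ω).card = q.natDegree := by
    rw [poles, roots_eq_of_associated hden, (IsAlgClosed.splits q).natDegree_eq_card_roots]
  have hzeroes : zeroes ω = s.roots := roots_eq_of_associated hnum
  subst hωsq
  constructor
  · have hiff : ∀ z, (frac s q).num.IsRoot z ↔ s.IsRoot z := fun z =>
      ⟨fun h => h.dvd hnum.dvd, fun h => h.dvd hnum.symm.dvd⟩
    simp only [hiff]
    refine ⟨fun hT z hz => not_isRoot_of_isFredholm_toeplitz hq hroot hsq hp' hT hz, fun hs => ?_⟩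
    have hs0 := hne hs
    obtain ⟨s₁, s₂, rfl, h₁, h₂⟩ := exists_factorization_of_not_isRoot hs0 hs
    exact isFredholm_toeplitz hq hroot (left_ne_zero_of_mul hs0) h₁ (right_ne_zero_of_mul hs0) h₂
  intro hs
  have hs0 := hne hs
  refine ⟨toL0_image_eq fun g => mem_domain_toeplitz_iff hq hroot hsq,
    toL0_image_eq fun g => mem_ran_toeplitz_iff hq hroot hsq, tildeP_le hq, ?_, ?_, ?_⟩
  · obtain ⟨s₁, s₂, rfl, h₁, h₂⟩ := exists_factorization_of_not_isRoot hs0 hs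
    have hs₁ := left_ne_zero_of_mul hs0
    have hs₂ := right_ne_zero_of_mul hs0
    rw [injective_toeplitz_iff hq hroot hs₁ h₁ hs₂ h₂,
      surjective_toeplitz_iff hq hroot hs₁ h₁ hs₂ h₂]
    exact le_total _ _
  · rw [hpoles, hzeroes]
    obtain ⟨s₁, s₂, rfl, h₁, h₂⟩ := exists_factorization_of_not_isRoot hs0 hs
    have hs₁ := left_ne_zero_of_mul hs0
    have hs₂ := right_ne_zero_of_mul hs0
    -- The two truncated differences of degrees subtract to the integer `deg q - deg s₁`.
    rw [card_filter_roots_mul hs0 h₁ h₂, LinearPMap.fredholmIndex,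
      finrank_kernel_toeplitz hq hroot hs₁ h₁ hs₂ h₂,
      finrank_quotient_ran_toeplitz hq hroot hs₁ h₁ hs₂ h₂]
    omega
  · rintro s₁ s₂ rfl h₁ h₂
    have hs₁ := left_ne_zero_of_mul hs0
    have hs₂ := right_ne_zero_of_mul hs0
    refine ⟨?_, isCompl_ran_toeplitz hq hroot hs₁ h₁ hs₂ h₂, ?_⟩
    · ext G
      constructor
      · rintro ⟨g, hg, rfl⟩
        obtain ⟨r, hr, e⟩ := (mem_kernel_toeplitz_iff hq hroot hs₁ h₁).1 hg
        exact ⟨r, hr, (smul_eq_polyHp_iff hs₂).1 e⟩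
      · rintro ⟨r, hr, rfl⟩
        obtain ⟨g, hg⟩ := exists_smul_eq_of_roots_outside _ s₂ hs₂ rfl h₂ (polyHp p r)
        exact ⟨g, (mem_kernel_toeplitz_iff hq hroot hs₁ h₁).2 ⟨r, hr, hg⟩,
          (smul_eq_polyHp_iff hs₂).1 hg⟩
    · rw [injective_toeplitz_iff hq hroot hs₁ h₁ hs₂ h₂,
        surjective_toeplitz_iff hq hroot hs₁ h₁ hs₂ h₂]
      omega
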